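/- Let $1<p<2$, let $p'$ be the conjugate exponent of $p$, $\frac1p+\frac1{p'}=1$ (so that $2<p'<\infty$), and let $p'\le q<\infty$. Let $X$ be a real or complex Banach space such that some closed subspace of $X$ that is the range of a continuous linear projection on $X$ is linearly homeomorphic to $\ell_p$ (a complemented copy of $\ell_p$), and some closed subspace of $X$, not necessarily complemented, is linearly homeomorphic to $\ell_q$ or to $c_0$; here $\ell_p$, $\ell_q$ and $c_0$ are the spaces of scalar sequences over the scalar field of $X$. For a Banach space $Z$, let $\mathcal{L}(Z)$ be the algebra of continuous linear operators on $Z$ with the operator norm; a closed ideal of $\mathcal{L}(Z)$ is a norm-closed linear subspace $\mathcal{I}$ with $BTA\in\mathcal{I}$ for all $T\in\mathcal{I}$ and $A,B\in\mathcal{L}(Z)$. Then $\mathcal{L}(X)$ contains two closed ideals neither of which is a subset of the other, and $\mathcal{L}(X^*)$, where $X^*$ is the dual Banach space, also contains two closed ideals neither of which is a subset of the other. In particular, neither the closed ideals of $\mathcal{L}(X)$ nor those of $\mathcal{L}(X^*)$ are linearly ordered by inclusion. -/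

import Mathlib

open scoped ENNReal ZeroAtInfty

/-- `X` contains a copy of `E`: some closed subspace of `X` is linearly homeomorphic to `E`. -/
def ContainsCopy (𝕜 E X : Type*) [RCLike 𝕜] [NormedAddCommGroup E] [NormedSpace 𝕜 E]
    [NormedAddCommGroup X] [NormedSpace 𝕜 X] : Prop :=
  ∃ W : Submodule 𝕜 X, IsClosed (W : Set X) ∧ Nonempty (E ≃L[𝕜] W)

/-- `X` contains a complemented copy of `E`: some subspace of `X` that is the range of a continuous
linear projection of `X` is linearly homeomorphic to `E`. -/
def ContainsComplementedCopy (𝕜 E X : Type*) [RCLike 𝕜] [NormedAddCommGroup E] [NormedSpace 𝕜 E]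
    [NormedAddCommGroup X] [NormedSpace 𝕜 X] : Prop :=
  ∃ W : Submodule 𝕜 X, W.ClosedComplemented ∧ Nonempty (E ≃L[𝕜] W)

/-- The operators on `X`, that is, the continuous linear maps from `X` to itself, with composition
as multiplication and the topology of the operator norm. -/
abbrev Operators (𝕜 X : Type*) [RCLike 𝕜] [NormedAddCommGroup X] [NormedSpace 𝕜 X] : Type _ :=
  X →L[𝕜] X

/-- The norm-closed two-sided ideals of the algebra of operators on `X`, ordered by inclusion.
Because this algebra is unital, its two-sided ideals as a ring are exactly the linear subspaces
that are stable under composition with operators on either side. -/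
abbrev ClosedIdeal (𝕜 X : Type*) [RCLike 𝕜] [NormedAddCommGroup X] [NormedSpace 𝕜 X] : Type _ :=
  {I : TwoSidedIdeal (Operators 𝕜 X) // IsClosed (I : Set (Operators 𝕜 X))}

/-! Two operators on `X` are built from a retraction `Q` of `X` onto `ℓ^p`, realised over the
disjoint union of the cubes `{0,1}^n`. One applies the normalized Walsh transform of each cube, `ℓ^p
→ ℓ^p'`, and then a map `J` of `ℓ^p'` into the copy of `ℓ^q` or `c₀`; this is where `p' ≤ q` enters.
The other extracts the Rademacher coefficients of each cube, `ℓ^p → ℓ^2`, and then maps the Hilbert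
space into the same copy.

Each bounded family of vectors indexed by the cubes defines a closed ideal: the operators `R` for
which every `R B` tends to zero on average along the family. Two families separate the two
operators.

Along the normalized Walsh functions, the Walsh operator produces unit vectors, while by Parseval an
operator through a Hilbert space has average norm at most a multiple of `2^(n(1/2 - 1/p))`, which
tends to zero as `p < 2` (`sum_norm_hilbert_walshVec_le`). Along the sums `∑ ± r_k / √m` of
Rademacher functions, the Rademacher operator followed by the Hilbert space map stays bounded below.
The hard point is that the Walsh operator is small there after any operator `B`, that is, on every
family `v_k` in `ℓ^p` with an upper `ℓ_2^m` estimate: the average norm of the images of `∑ ± v_k` is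
at most a multiple of `m^(1/p')`, which is `o(√m)` (`exists_sum_norm_walshOp_rpow_le`).

That estimate rests on a Hilbert-valued Hausdorff–Young inequality
(`sum_norm_rpow_le_of_weak_strong`) with bound `w^(p'-2) s^2` in terms of the weak norm `w` and the
strong norm `s`. Khinchin's inequality turns the family into one Hilbert-valued function with `w`
bounded and `s` of order `√m`, so only the factor `s^2` depends on `m`.

For `X*`, the same construction is carried out on the bidual, where reflexivity of `ℓ^p` keeps the
factorizations intact; ideals are then pulled back by transposition. -/

/-! ### Continuity of maps into sequence spaces, and block sums -/

section SequenceSpaces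
open Filter Topology

variable {𝕜 : Type*} [RCLike 𝕜] {E : Type*} [NormedAddCommGroup E] [NormedSpace 𝕜 E]

/-- By the closed graph theorem, a linear map into `ℓ^p` with continuous coordinates is
continuous. -/
noncomputable def lpCLM [CompleteSpace E] {ι : Type*} (p : ℝ≥0∞) [Fact (1 ≤ p)]
    (A : ι → E →L[𝕜] 𝕜) (h : ∀ x, Memℓp (fun i => A i x) p) : E →L[𝕜] lp (fun _ : ι => 𝕜) p :=
  let L : E →ₗ[𝕜] lp (fun _ : ι => 𝕜) p :=
    { toFun := fun x => ⟨fun i => A i x, h x⟩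
      map_add' := fun x y => lp.ext (funext fun i => map_add (A i) x y)
      map_smul' := fun c x => lp.ext (funext fun i => map_smul (A i) c x) }
  ⟨L, L.continuous_of_seq_closed_graph fun u x y hu hy => by
    ext i
    have h1 : Tendsto (fun n => (lp.evalCLM 𝕜 (fun _ : ι => 𝕜) p i) (L (u n))) atTop
        (𝓝 (lp.evalCLM 𝕜 (fun _ : ι => 𝕜) p i y)) :=
      ((lp.evalCLM 𝕜 (fun _ : ι => 𝕜) p i).continuous.tendsto y).comp hy
    have h2 : Tendsto (fun n => A i (u n)) atTop (𝓝 (A i x)) :=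
      ((A i).continuous.tendsto x).comp hu
    exact tendsto_nhds_unique h1 h2⟩

@[simp] lemma lpCLM_apply [CompleteSpace E] {ι : Type*} (p : ℝ≥0∞) [Fact (1 ≤ p)]
    (A : ι → E →L[𝕜] 𝕜) (h : ∀ x, Memℓp (fun i => A i x) p) (x : E) (i : ι) :
    lpCLM p A h x i = A i x := rfl

/-- By the closed graph theorem, a linear map into `c₀` with continuous coordinates is
continuous. -/
noncomputable def zeroAtInftyCLM [CompleteSpace E] (A : ℕ → E →L[𝕜] 𝕜)
    (h : ∀ x, Tendsto (fun i => A i x) cofinite (𝓝 0)) : E →L[𝕜] C₀(ℕ, 𝕜) :=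
  let L : E →ₗ[𝕜] C₀(ℕ, 𝕜) :=
    { toFun := fun x =>
        { toFun := fun i => A i x
          continuous_toFun := continuous_of_discreteTopology
          zero_at_infty' := by rw [cocompact_eq_cofinite]; exact h x }
      map_add' := fun x y => by ext i; simp
      map_smul' := fun c x => by ext i; simp }
  ⟨L, L.continuous_of_seq_closed_graph fun u x y hu hy => by
    ext i
    have h1 : Tendsto (fun n => L (u n) i) atTop (𝓝 (y i)) := by
      rw [tendsto_iff_norm_sub_tendsto_zero] at hy ⊢
      refine squeeze_zero (fun _ => norm_nonneg _) (fun n => ?_) hy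
      exact (L (u n) - y).toBCF.norm_coe_le_norm i
    have h2 : Tendsto (fun n => A i (u n)) atTop (𝓝 (A i x)) :=
      ((A i).continuous.tendsto x).comp hu
    exact tendsto_nhds_unique h1 h2⟩

@[simp] lemma zeroAtInftyCLM_apply [CompleteSpace E] (A : ℕ → E →L[𝕜] 𝕜)
    (h : ∀ x, Tendsto (fun i => A i x) cofinite (𝓝 0)) (x : E) (i : ℕ) :
    zeroAtInftyCLM A h x i = A i x := rfl

/-- The inclusion `ℓ^p ⊆ ℓ^q` for `p ≤ q`. -/
noncomputable def lpInclusion (𝕜 : Type*) [RCLike 𝕜] (ι : Type*) {p q : ℝ≥0∞} [Fact (1 ≤ p)]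
    [Fact (1 ≤ q)] (h : p ≤ q) : lp (fun _ : ι => 𝕜) p →L[𝕜] lp (fun _ : ι => 𝕜) q :=
  lpCLM q (lp.evalCLM 𝕜 (fun _ : ι => 𝕜) p) fun x => (lp.memℓp x).of_exponent_ge h

/-- Reindexing of an `ℓ^p` space. -/
noncomputable def lpReindex (𝕜 : Type*) [RCLike 𝕜] {ι κ : Type*} {p : ℝ≥0∞} [Fact (1 ≤ p)]
    (hp : 0 < p.toReal) (e : κ ≃ ι) : lp (fun _ : ι => 𝕜) p →L[𝕜] lp (fun _ : κ => 𝕜) p :=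
  lpCLM p (fun k => lp.evalCLM 𝕜 (fun _ : ι => 𝕜) p (e k)) fun x =>
    memℓp_gen (((lp.memℓp x).summable hp).comp_injective e.injective)

@[simp] lemma lpInclusion_apply {ι : Type*} {p q : ℝ≥0∞} [Fact (1 ≤ p)]
    [Fact (1 ≤ q)] (h : p ≤ q) (x : lp (fun _ : ι => 𝕜) p) (i : ι) :
    lpInclusion 𝕜 ι h x i = x i := rfl

@[simp] lemma lpReindex_apply {ι κ : Type*} {p : ℝ≥0∞} [Fact (1 ≤ p)]
    (hp : 0 < p.toReal) (e : κ ≃ ι) (x : lp (fun _ : ι => 𝕜) p) (k : κ) :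
    lpReindex 𝕜 hp e x k = x (e k) := rfl

lemma hasSum_block_norm {α : ℕ → Type*} [∀ n, Fintype (α n)] {p : ℝ≥0∞} (hp : 0 < p.toReal)
    (x : lp (fun _ : (Σ n, α n) => 𝕜) p) :
    HasSum (fun n => ∑ a, ‖x ⟨n, a⟩‖ ^ p.toReal) (‖x‖ ^ p.toReal) :=
  (lp.hasSum_norm hp x).sigma fun n => hasSum_fintype fun a => ‖x ⟨n, a⟩‖ ^ p.toReal

lemma memℓp_of_summable_block {α : ℕ → Type*} [∀ n, Fintype (α n)] {p : ℝ≥0∞}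
    {x : (Σ n, α n) → 𝕜} (h : Summable fun n => ∑ a, ‖x ⟨n, a⟩‖ ^ p.toReal) : Memℓp x p := by
  refine memℓp_gen ((summable_sigma_of_nonneg fun i => by positivity).2 ⟨fun n => ?_, ?_⟩)
  · exact (hasSum_fintype _).summable
  · simpa only [tsum_fintype] using h

/-- If `t` has sum `T`, then powers of exponent `≥ 1` of `t` are dominated by a multiple of `t`. -/
lemma rpow_le_of_hasSum {t : ℕ → ℝ} {T r : ℝ} (ht : ∀ n, 0 ≤ t n) (h : HasSum t T) (hr : 1 ≤ r)
    (n : ℕ) : t n ^ r ≤ T ^ (r - 1) * t n := by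
  have h1 : t n ≤ T := le_hasSum h n fun m _ => ht m
  rcases (ht n).eq_or_lt with h0 | h0
  · rw [← h0, Real.zero_rpow (by linarith), mul_zero]
  · calc t n ^ r = t n ^ (r - 1) * t n := by
          rw [← Real.rpow_add_one h0.ne']; congr 1; ring
      _ ≤ _ := by gcongr

/-- An operator between `ℓ^p` spaces that acts on blocks. -/
lemma memℓp_block {α β : ℕ → Type*} [∀ n, Fintype (α n)] [∀ n, Fintype (β n)] {p q : ℝ≥0∞}
    (hp : 0 < p.toReal) (hpq : p.toReal ≤ q.toReal) (x : lp (fun _ : (Σ n, α n) => 𝕜) p)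
    {y : (Σ n, β n) → 𝕜} (C : ℝ)
    (h : ∀ n, ∑ b, ‖y ⟨n, b⟩‖ ^ q.toReal ≤
      C * (∑ a, ‖x ⟨n, a⟩‖ ^ p.toReal) ^ (q.toReal / p.toReal)) : Memℓp y q := by
  have hs := hasSum_block_norm hp x
  have hr : 1 ≤ q.toReal / p.toReal := (one_le_div hp).2 hpq
  -- The exponent `q/p ≥ 1` makes the block bounds summable: they are dominated by a multiple of the
  -- summable sequence of block norms. `|C|` appears because `C` carries no sign assumption.
  refine memℓp_of_summable_block (Summable.of_nonneg_of_le (fun n => by positivity) (fun n => ?_)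
    (hs.summable.mul_left (|C| * (‖x‖ ^ p.toReal) ^ (q.toReal / p.toReal - 1))))
  calc _ ≤ _ := h n
    _ ≤ |C| * (∑ a, ‖x ⟨n, a⟩‖ ^ p.toReal) ^ (q.toReal / p.toReal) := by
        gcongr; exact le_abs_self C
    _ ≤ _ := by
        rw [mul_assoc]
        gcongr
        exact rpow_le_of_hasSum (fun n => by positivity) hs hr n

end SequenceSpaces

/-! ### Walsh and Rademacher functions; Parseval's identity -/

section Walsh

/-- The Walsh character of `{0,1}^n` with index `A`. -/
def walsh {n : ℕ} (A ω : Fin n → Bool) : ℝ := ∏ k, if A k && ω k then -1 else 1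

lemma walsh_comm {n : ℕ} (A ω : Fin n → Bool) : walsh A ω = walsh ω A := by
  simp [walsh, and_comm]

lemma abs_walsh {n : ℕ} (A ω : Fin n → Bool) : |walsh A ω| = 1 := by
  rw [walsh, Finset.abs_prod]
  refine Finset.prod_eq_one fun k _ => ?_
  split_ifs <;> simp

lemma sum_prod_bool {n : ℕ} (f : Fin n → Bool → ℝ) :
    ∑ ω : Fin n → Bool, ∏ k, f k (ω k) = ∏ k, ∑ b, f k b := by
  rw [Finset.prod_univ_sum, Fintype.piFinset_univ]

lemma sum_walsh_mul_walsh {n : ℕ} (A B : Fin n → Bool) :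
    ∑ ω, walsh A ω * walsh B ω = if A = B then 2 ^ n else 0 := by
  simp_rw [walsh, ← Finset.prod_mul_distrib]
  rw [sum_prod_bool fun k b => (if A k && b then (-1 : ℝ) else 1) * if B k && b then -1 else 1]
  split_ifs with hAB
  · subst hAB
    have : ∀ k, ∑ b : Bool, ((if A k && b then (-1 : ℝ) else 1) *
        if A k && b then -1 else 1) = 2 := by
      intro k
      cases A k <;> norm_num
    rw [Finset.prod_congr rfl fun k _ => this k]
    simp
  · obtain ⟨k, hk⟩ := Function.ne_iff.1 hAB
    refine Finset.prod_eq_zero (Finset.mem_univ k) ?_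
    revert hk
    cases A k <;> cases B k <;> simp

variable {𝕜 : Type*} [RCLike 𝕜] {H : Type*} [NormedAddCommGroup H] [InnerProductSpace 𝕜 H]

/-- Expanding the squared norm leaves only diagonal terms, so Parseval holds with values in any
inner product space, with the scalar constant. -/
lemma sum_norm_sq_of_orthogonal {ι κ : Type*} [Fintype ι] [Fintype κ] [DecidableEq κ]
    {f : κ → ι → ℝ} {N : ℝ} (hf : ∀ j k, ∑ i, f j i * f k i = if j = k then N else 0)
    (x : κ → H) : ∑ i, ‖∑ j, (f j i : 𝕜) • x j‖ ^ 2 = N * ∑ j, ‖x j‖ ^ 2 := by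
  have hf' : ∀ j k, ∑ i, (f j i : 𝕜) * (f k i : 𝕜) = if j = k then (N : 𝕜) else 0 := fun j k => by
    have := congrArg (fun t : ℝ => (t : 𝕜)) (hf j k)
    push_cast at this
    rw [this]
    split_ifs <;> simp
  have key : ∑ i, (inner 𝕜 (∑ j, (f j i : 𝕜) • x j) (∑ j, (f j i : 𝕜) • x j)) =
      N * ∑ j, inner 𝕜 (x j) (x j) := by
    simp only [sum_inner, inner_sum, inner_smul_left, inner_smul_right, RCLike.conj_ofReal]
    simp_rw [Finset.mul_sum]
    rw [Finset.sum_comm]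
    refine Finset.sum_congr rfl fun j _ => ?_
    rw [Finset.sum_comm]
    calc ∑ k, ∑ i, (f j i : 𝕜) * ((f k i : 𝕜) * inner 𝕜 (x k) (x j))
        = ∑ k, (if j = k then (N : 𝕜) else 0) * inner 𝕜 (x k) (x j) := by
          refine Finset.sum_congr rfl fun k _ => ?_
          rw [← hf', Finset.sum_mul]
          exact Finset.sum_congr rfl fun i _ => by ring
      _ = _ := by simp
  simp only [inner_self_eq_norm_sq_to_K] at key
  exact_mod_cast key

/-- Parseval's identity for the Walsh transform. -/
lemma sum_norm_sq_walsh {n : ℕ} (x : (Fin n → Bool) → H) :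
    ∑ A, ‖∑ ω, (walsh A ω : 𝕜) • x ω‖ ^ 2 = 2 ^ n * ∑ ω, ‖x ω‖ ^ 2 :=
  sum_norm_sq_of_orthogonal (f := fun ω A => walsh A ω)
    (fun ω ω' => by simp_rw [walsh_comm _ ω, walsh_comm _ ω']; exact sum_walsh_mul_walsh ω ω') x

/-- The `k`-th Rademacher function on `{0,1}^m`. -/
def rademacher {m : ℕ} (k : Fin m) (ε : Fin m → Bool) : ℝ := if ε k then -1 else 1

/-- Rademacher functions are the Walsh characters of singletons, so they inherit orthogonality. -/
lemma rademacher_eq_walsh {m : ℕ} (k : Fin m) (ε : Fin m → Bool) :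
    rademacher k ε = walsh (fun j => decide (j = k)) ε := by
  rw [walsh, Finset.prod_eq_single k]
  · simp [rademacher]
  · intro j _ hj; simp [hj]
  · simp

lemma abs_rademacher {m : ℕ} (k : Fin m) (ε : Fin m → Bool) : |rademacher k ε| = 1 := by
  rw [rademacher_eq_walsh, abs_walsh]

lemma rademacher_mul_self {m : ℕ} (k : Fin m) (ε : Fin m → Bool) :
    rademacher k ε * rademacher k ε = 1 := by
  rw [← abs_mul_abs_self, abs_rademacher, one_mul]

lemma sum_rademacher_mul_rademacher {m : ℕ} (j k : Fin m) :
    ∑ ε, rademacher j ε * rademacher k ε = if j = k then 2 ^ m else 0 := by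
  simp_rw [rademacher_eq_walsh]
  rw [sum_walsh_mul_walsh]
  congr 1
  simp only [eq_iff_iff, funext_iff, decide_eq_decide]
  exact ⟨fun h => (h j).1 rfl, fun h i => by rw [h]⟩

lemma sum_norm_sq_rademacher {m : ℕ} (x : Fin m → H) :
    ∑ ε, ‖∑ k, (rademacher k ε : 𝕜) • x k‖ ^ 2 = 2 ^ m * ∑ k, ‖x k‖ ^ 2 :=
  sum_norm_sq_of_orthogonal sum_rademacher_mul_rademacher x

end Walsh

/-! ### Hausdorff–Young inequality with weak and strong norms -/

section HausdorffYoung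
open MeasureTheory Set

lemma lintegral_Ioi_indicator_rpow {s a : ℝ} (hs : -1 < s) (ha : 0 ≤ a) :
    ∫⁻ t in Ioi 0, (Iic a).indicator (fun t => ENNReal.ofReal (t ^ s)) t =
      ENNReal.ofReal (a ^ (s + 1) / (s + 1)) := by
  rw [lintegral_indicator measurableSet_Iic, Measure.restrict_restrict measurableSet_Iic,
    inter_comm, Ioi_inter_Iic, ← ofReal_integral_eq_lintegral_ofReal,
    ← intervalIntegral.integral_of_le ha, integral_rpow (Or.inl hs),
    Real.zero_rpow (by linarith), sub_zero]
  · refine (intervalIntegrable_iff_integrableOn_Ioc_of_le ha).1 ?_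
    exact intervalIntegral.intervalIntegrable_rpow' hs
  · filter_upwards [ae_restrict_mem measurableSet_Ioc] with t ht
    exact Real.rpow_nonneg ht.1.le _

/-- A weak type bound, integrated over all heights. -/
lemma sum_rpow_le_of_weak {ι κ : Type*} [Fintype ι] [Fintype κ] {y : ι → ℝ} {b c : κ → ℝ} {r : ℝ}
    (hr : 2 < r) (hy : ∀ i, 0 ≤ y i) (hb : ∀ j, 0 ≤ b j) (hc : ∀ j, 0 ≤ c j)
    (h : ∀ t : ℝ, 0 < t →
      ∑ i, (if t ≤ y i then t ^ 2 else 0) ≤ ∑ j, if t ≤ c j then b j else 0) :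
    ∑ i, y i ^ r ≤ r / (r - 2) * ∑ j, b j * c j ^ (r - 2) := by
  have hm : ∀ s a : ℝ, Measurable ((Iic a).indicator fun t : ℝ => ENNReal.ofReal (t ^ s)) :=
    fun s a => (by fun_prop : Measurable fun t : ℝ => ENNReal.ofReal (t ^ s)).indicator
      measurableSet_Iic
  have h1 : ∑ i, ENNReal.ofReal (y i ^ r / r) ≤
      ∑ j, ENNReal.ofReal (b j) * ENNReal.ofReal (c j ^ (r - 2) / (r - 2)) := by
    -- The hypothesis is multiplied by `t^(r-3)` and integrated over `t > 0`; the integral of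
    -- `t^(r-3)` up to `c j` converges because `r > 2`.
    calc ∑ i, ENNReal.ofReal (y i ^ r / r)
        = ∑ i, ∫⁻ t in Ioi 0, (Iic (y i)).indicator (fun t => ENNReal.ofReal (t ^ (r - 1))) t := by
          refine Finset.sum_congr rfl fun i _ => ?_
          rw [lintegral_Ioi_indicator_rpow (by linarith) (hy i), sub_add_cancel]
      _ = ∫⁻ t in Ioi 0, ∑ i, (Iic (y i)).indicator (fun t => ENNReal.ofReal (t ^ (r - 1))) t :=
          (lintegral_finsetSum _ fun i _ => hm _ _).symm
      _ ≤ ∫⁻ t in Ioi 0, ∑ j, ENNReal.ofReal (b j) *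
            (Iic (c j)).indicator (fun t => ENNReal.ofReal (t ^ (r - 3))) t := by
          refine setLIntegral_mono' measurableSet_Ioi fun t ht => ?_
          have ht : 0 < t := ht
          have e1 : ∀ i, (Iic (y i)).indicator (fun t => ENNReal.ofReal (t ^ (r - 1))) t =
              ENNReal.ofReal ((if t ≤ y i then t ^ 2 else 0) * t ^ (r - 3)) := fun i => by
            rw [indicator_apply]
            simp only [mem_Iic]
            split_ifs
            · rw [← Real.rpow_natCast, ← Real.rpow_add ht]; congr 2; push_cast; ring
            · simp
          have e2 : ∀ j, ENNReal.ofReal (b j) *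
              (Iic (c j)).indicator (fun t => ENNReal.ofReal (t ^ (r - 3))) t =
              ENNReal.ofReal ((if t ≤ c j then b j else 0) * t ^ (r - 3)) := fun j => by
            rw [indicator_apply]
            simp only [mem_Iic]
            split_ifs
            · rw [ENNReal.ofReal_mul (hb j)]
            · simp
          simp_rw [e1, e2]
          rw [← ENNReal.ofReal_sum_of_nonneg, ← ENNReal.ofReal_sum_of_nonneg, ← Finset.sum_mul,
            ← Finset.sum_mul]
          · have := h t ht
            gcongr
          · intro j _
            have := hb j
            split_ifs <;> positivity
          · intro i _
            split_ifs <;> positivity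
      _ = ∑ j, ENNReal.ofReal (b j) * ∫⁻ t in Ioi 0,
            (Iic (c j)).indicator (fun t => ENNReal.ofReal (t ^ (r - 3))) t := by
          rw [lintegral_finsetSum _ fun j _ => (hm _ _).const_mul _]
          exact Finset.sum_congr rfl fun j _ => lintegral_const_mul _ (hm _ _)
      _ = _ := by
          refine Finset.sum_congr rfl fun j _ => ?_
          rw [lintegral_Ioi_indicator_rpow (by linarith) (hc j)]
          ring_nf
  have hr0 : 0 < r - 2 := by linarith
  have hr1 : 0 < r := by linarith
  simp_rw [← ENNReal.ofReal_mul (hb _)] at h1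
  rw [← ENNReal.ofReal_sum_of_nonneg, ← ENNReal.ofReal_sum_of_nonneg,
    ENNReal.ofReal_le_ofReal_iff] at h1
  · rw [← Finset.sum_div, div_le_iff₀ hr1] at h1
    refine h1.trans (le_of_eq ?_)
    rw [Finset.sum_mul, Finset.mul_sum]
    exact Finset.sum_congr rfl fun j _ => by ring
  · exact Finset.sum_nonneg fun j _ =>
      mul_nonneg (hb j) (div_nonneg (Real.rpow_nonneg (hc j) _) hr0.le)
  · exact fun j _ => mul_nonneg (hb j) (div_nonneg (Real.rpow_nonneg (hc j) _) hr0.le)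
  · exact fun i _ => div_nonneg (Real.rpow_nonneg (hy i) _) hr1.le

/-- A Hausdorff–Young inequality for Hilbert space valued functions, with the strong `p`-norm
bounded by `s` and the weak `p`-norm bounded by `w`. -/
theorem sum_norm_rpow_le_of_weak_strong {𝕜 ι κ H : Type*} [RCLike 𝕜] [Fintype ι] [Fintype κ]
    [NormedAddCommGroup H] [InnerProductSpace 𝕜 H] {k : ι → κ → 𝕜} (hk : ∀ i j, ‖k i j‖ ≤ 1)
    {N : ℝ} (hN : 0 ≤ N)
    (hB : ∀ x : κ → H, ∑ i, ‖∑ j, k i j • x j‖ ^ 2 ≤ N * ∑ j, ‖x j‖ ^ 2)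
    {p p' : ℝ} (hp1 : 1 < p) (hp2 : p < 2) (hpp' : p.HolderConjugate p') {x : κ → H} {s w : ℝ}
    (hs : 0 ≤ s) (hw : 0 < w) (hxs : ∑ j, ‖x j‖ ^ p ≤ s ^ p)
    (hxw : ∀ a : H, ∑ j, ‖inner 𝕜 a (x j)‖ ^ p ≤ (w * ‖a‖) ^ p) :
    ∑ i, ‖∑ j, k i j • x j‖ ^ p' ≤
      4 * (p' / (p' - 2)) * 2 ^ (p' - 2) * N * w ^ (p' - 2) * s ^ 2 := by
  classical
  have hmul : (p - 1) * p' = p := hpp'.sub_one_mul_conj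
  have hp' : 2 < p' := by nlinarith
  have hp0 : 0 < p := by linarith
  have hp'0 : 0 < p' := by linarith
  rcases hs.eq_or_lt with rfl | hs
  · have hx : ∀ j, x j = 0 := fun j => by
      rw [Real.zero_rpow hp0.ne'] at hxs
      have := (Finset.sum_eq_zero_iff_of_nonneg (fun j _ => by positivity)).1
        (le_antisymm hxs (Finset.sum_nonneg fun j _ => by positivity)) j (Finset.mem_univ j)
      rwa [Real.rpow_eq_zero (norm_nonneg _) hp0.ne', norm_eq_zero] at this
    simp [hx, Real.zero_rpow hp'0.ne']
  -- Truncation level of a real-interpolation argument: at height `t` the long vectors, those with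
  -- `c j < t`, are split off. The factor `2 * w` is what makes their total contribution at most `t
  -- / 2`.
  set c : κ → ℝ := fun j => 2 * w * (s / ‖x j‖) ^ (p - 1) with hcdef
  have hc : ∀ j, 0 ≤ c j := fun j => by positivity
  have tail : ∀ t : ℝ, 0 < t → ∀ i, ‖∑ j, k i j • (if t ≤ c j then 0 else x j)‖ ≤ t / 2 := by
    intro t ht i
    -- Since `s / 0 = 0`, a zero vector has `c j = 0` and falls into the tail; it contributes
    -- nothing but must not be counted.
    set R : Finset κ := Finset.univ.filter fun j => ¬ t ≤ c j ∧ x j ≠ 0 with hR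
    have hsum : ∑ j, k i j • (if t ≤ c j then 0 else x j) = ∑ j ∈ R, k i j • x j := by
      rw [hR, Finset.sum_filter]
      refine Finset.sum_congr rfl fun j _ => ?_
      by_cases h1 : t ≤ c j <;> by_cases h2 : x j = 0 <;> simp [h1, h2]
    -- Chebyshev's inequality for the strong norm: the lower bound on `‖x j‖ ^ (p - 1)` is raised to
    -- the power `p'`, with `(p - 1) p' = p`.
    have hcard : (R.card : ℝ) ≤ (t / (2 * w)) ^ p' := by
      have h1 : ∀ j ∈ R, (2 * w / t) ^ p' * s ^ p ≤ ‖x j‖ ^ p := fun j hj => by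
        obtain ⟨hj1, hj2⟩ := (Finset.mem_filter.1 hj).2
        have hx : 0 < ‖x j‖ := norm_pos_iff.2 hj2
        have h2 : 2 * w * s ^ (p - 1) ≤ t * ‖x j‖ ^ (p - 1) := by
          have h3 := (not_le.1 hj1).le
          rw [hcdef] at h3
          simp only at h3
          rw [Real.div_rpow hs.le hx.le, ← mul_div_assoc, div_le_iff₀ (by positivity)] at h3
          exact h3
        have h4 : 2 * w / t * s ^ (p - 1) ≤ ‖x j‖ ^ (p - 1) := by
          rw [div_mul_eq_mul_div, div_le_iff₀ ht]; linarith
        calc (2 * w / t) ^ p' * s ^ p = (2 * w / t * s ^ (p - 1)) ^ p' := by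
              rw [Real.mul_rpow (by positivity) (by positivity), ← Real.rpow_mul hs.le, hmul]
          _ ≤ (‖x j‖ ^ (p - 1)) ^ p' := by gcongr
          _ = ‖x j‖ ^ p := by rw [← Real.rpow_mul hx.le, hmul]
      have h2 : R.card * ((2 * w / t) ^ p' * s ^ p) ≤ s ^ p := by
        calc R.card * ((2 * w / t) ^ p' * s ^ p) ≤ ∑ j ∈ R, ‖x j‖ ^ p := by
              rw [← nsmul_eq_mul]; exact Finset.card_nsmul_le_sum _ _ _ h1
          _ ≤ ∑ j, ‖x j‖ ^ p := Finset.sum_le_univ_sum_of_nonneg fun j => by positivity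
          _ ≤ s ^ p := hxs
      have hsp : 0 < s ^ p := by positivity
      have h3 : R.card * (2 * w / t) ^ p' ≤ 1 := by
        rw [← mul_assoc] at h2
        exact le_of_mul_le_mul_right (by linarith) hsp
      rwa [← inv_div, Real.inv_rpow (by positivity), ← one_div, le_div_iff₀ (by positivity)]
    rw [hsum]
    set Y := ∑ j ∈ R, k i j • x j with hY
    rcases (norm_nonneg Y).eq_or_lt with h0 | h0
    · rw [← h0]; positivity
    -- Testing `Y` against itself brings in the weak norm; Hölder on the few indices of `R` then
    -- gives `‖Y‖ ≤ t / 2`.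
    have h1 : ‖Y‖ ^ 2 ≤ ∑ j ∈ R, ‖inner 𝕜 Y (x j)‖ := by
      have e : ‖Y‖ ^ 2 = ‖inner 𝕜 Y Y‖ := by
        rw [inner_self_eq_norm_sq_to_K]; simp
      rw [e]
      nth_rewrite 2 [hY]
      rw [inner_sum]
      refine (norm_sum_le _ _).trans (Finset.sum_le_sum fun j _ => ?_)
      rw [inner_smul_right, norm_mul]
      exact mul_le_of_le_one_left (norm_nonneg _) (hk i j)
    have h2 : ∑ j ∈ R, ‖inner 𝕜 Y (x j)‖ ≤ (w * ‖Y‖) * (t / (2 * w)) := by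
      have h3 := Real.inner_le_Lp_mul_Lq R (fun j => ‖inner 𝕜 Y (x j)‖) (fun _ => 1) hpp'
      simp only [mul_one, abs_norm, abs_one, Real.one_rpow, Finset.sum_const, nsmul_eq_mul] at h3
      refine h3.trans ?_
      gcongr
      · rw [one_div, Real.rpow_inv_le_iff_of_pos (Finset.sum_nonneg fun j _ => by positivity)
          (by positivity) hp0]
        exact (Finset.sum_le_univ_sum_of_nonneg fun j => by positivity).trans (hxw Y)
      · rwa [one_div, Real.rpow_inv_le_iff_of_pos (by positivity) (by positivity) hp'0]
    have h3 : ‖Y‖ * ‖Y‖ ≤ t / 2 * ‖Y‖ := by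
      have : w * ‖Y‖ * (t / (2 * w)) = t / 2 * ‖Y‖ := by field_simp
      nlinarith
    exact le_of_mul_le_mul_right h3 h0
  have key := sum_rpow_le_of_weak (y := fun i => ‖∑ j, k i j • x j‖)
    (b := fun j => 4 * N * ‖x j‖ ^ 2) (c := c) hp' (fun i => norm_nonneg _)
    (fun j => by positivity) hc ?_
  · refine key.trans ?_
    -- As `(p - 1)(p' - 2) = 2 - p`, the weight `c j ^ (p' - 2)` turns `‖x j‖ ^ 2` into a multiple
    -- of `‖x j‖ ^ p`.
    have e : ∀ j, 4 * N * ‖x j‖ ^ 2 * c j ^ (p' - 2) =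
        4 * N * (2 * w) ^ (p' - 2) * s ^ (2 - p) * ‖x j‖ ^ p := fun j => by
      rcases (norm_nonneg (x j)).eq_or_lt with h0 | h0
      · rw [← h0, Real.zero_rpow hp0.ne']; simp
      · have h1 : c j ^ (p' - 2) = (2 * w) ^ (p' - 2) * (s ^ (2 - p) / ‖x j‖ ^ (2 - p)) := by
          rw [hcdef]
          simp only
          rw [Real.mul_rpow (by positivity) (by positivity), ← Real.rpow_mul (by positivity),
            ← Real.div_rpow hs.le h0.le]
          congr 2
          linarith
        have h2 : ‖x j‖ ^ 2 = ‖x j‖ ^ (2 - p) * ‖x j‖ ^ p := by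
          rw [← Real.rpow_add h0, ← Real.rpow_natCast]; congr 1; push_cast; ring
        rw [h1, h2]
        field_simp
    simp_rw [e]
    rw [← Finset.mul_sum]
    have h3 : s ^ 2 = s ^ (2 - p) * s ^ p := by
      rw [← Real.rpow_add hs, ← Real.rpow_natCast]; congr 1; push_cast; ring
    have hq : 0 < p' / (p' - 2) := div_pos hp'0 (by linarith)
    calc p' / (p' - 2) * (4 * N * (2 * w) ^ (p' - 2) * s ^ (2 - p) * ∑ j, ‖x j‖ ^ p)
        ≤ p' / (p' - 2) * (4 * N * (2 * w) ^ (p' - 2) * s ^ (2 - p) * s ^ p) := by gcongr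
      _ = _ := by rw [h3, Real.mul_rpow (by norm_num) hw.le]; ring
  · intro t ht
    -- If the whole sum reaches `t`, the part kept must reach `t / 2`, hence the factor 4; the `ℓ^2`
    -- bound applies to that part.
    have h1 : ∀ i, (if t ≤ ‖∑ j, k i j • x j‖ then t ^ 2 else 0) ≤
        4 * ‖∑ j, k i j • (if t ≤ c j then x j else 0)‖ ^ 2 := fun i => by
      split_ifs with h
      · have h2 : ∑ j, k i j • x j = ∑ j, k i j • (if t ≤ c j then x j else 0) +
            ∑ j, k i j • (if t ≤ c j then 0 else x j) := by
          rw [← Finset.sum_add_distrib]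
          exact Finset.sum_congr rfl fun j _ => by split_ifs <;> simp
        have h3 := norm_add_le (∑ j, k i j • (if t ≤ c j then x j else 0))
          (∑ j, k i j • (if t ≤ c j then 0 else x j))
        rw [← h2] at h3
        have := tail t ht i
        nlinarith
      · positivity
    calc _ ≤ ∑ i, 4 * ‖∑ j, k i j • (if t ≤ c j then x j else 0)‖ ^ 2 :=
          Finset.sum_le_sum fun i _ => h1 i
      _ ≤ 4 * (N * ∑ j, ‖if t ≤ c j then x j else 0‖ ^ 2) := by
          rw [← Finset.mul_sum]; gcongr; exact hB _
      _ = _ := by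
          rw [← mul_assoc, Finset.mul_sum]
          exact Finset.sum_congr rfl fun j _ => by split_ifs <;> simp

end HausdorffYoung

/-! ### Khinchin's inequalities and Rademacher coefficients -/

section Khinchin

lemma exists_abs_rpow_le_cosh {r : ℝ} (hr : 0 < r) :
    ∃ K : ℝ, 0 < K ∧ ∀ y : ℝ, |y| ^ r ≤ K * Real.cosh y := by
  obtain ⟨n, hn⟩ := exists_nat_ge r
  refine ⟨1 + 2 * n.factorial, by positivity, fun y => ?_⟩
  have h1 : |y| ^ r ≤ 1 + |y| ^ n := by
    rcases le_total |y| 1 with h | h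
    · have := Real.rpow_le_one (abs_nonneg y) h hr.le
      have : 0 ≤ |y| ^ n := by positivity
      linarith
    · have := Real.rpow_le_rpow_of_exponent_le h hn
      rw [Real.rpow_natCast] at this
      linarith
  have h2 : |y| ^ n ≤ n.factorial * Real.exp |y| := by
    have := Real.pow_div_factorial_le_exp |y| (abs_nonneg y) n
    rwa [div_le_iff₀' (by positivity)] at this
  have h3 : Real.exp |y| ≤ 2 * Real.cosh y := by
    rw [← Real.cosh_abs, Real.cosh_eq]
    have := Real.exp_pos (-|y|)
    linarith
  have h4 := Real.one_le_cosh y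
  have h5 : (n.factorial : ℝ) * Real.exp |y| ≤ n.factorial * (2 * Real.cosh y) := by gcongr
  nlinarith

/-- By independence the exponential moments factor into `cosh (a k)`, each at most `exp (a k ^ 2 /
2)`. The sub-Gaussian bound gives all moments at once. -/
lemma sum_cosh_rademacher_le {m : ℕ} (a : Fin m → ℝ) :
    ∑ ε, Real.cosh (∑ k, rademacher k ε * a k) ≤ 2 ^ m * Real.exp ((∑ k, a k ^ 2) / 2) := by
  have h : ∀ a : Fin m → ℝ, ∑ ε, Real.exp (∑ k, rademacher k ε * a k) =
      ∏ k, (2 * Real.cosh (a k)) := by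
    intro a
    simp_rw [Real.exp_sum, rademacher]
    rw [sum_prod_bool fun k b => Real.exp ((if b then -1 else 1) * a k)]
    refine Finset.prod_congr rfl fun k _ => ?_
    simp only [Real.cosh_eq, Fintype.sum_bool, if_true, Bool.false_eq_true, if_false, neg_one_mul,
      one_mul]
    ring
  have h2 : ∑ ε, Real.cosh (∑ k, rademacher k ε * a k) = ∏ k, (2 * Real.cosh (a k)) := by
    have h3 := h (fun k => - a k)
    simp only [mul_neg, Finset.sum_neg_distrib, Real.cosh_neg] at h3
    simp_rw [Real.cosh_eq, add_div, Finset.sum_add_distrib, ← Finset.sum_div]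
    rw [h, h3, add_halves]
    exact Finset.prod_congr rfl fun k _ => by rw [Real.cosh_eq, add_div]
  rw [h2, Finset.prod_mul_distrib, Finset.sum_div, Real.exp_sum]
  simp only [Finset.prod_const, Finset.card_univ, Fintype.card_fin]
  gcongr with k
  exact Real.cosh_le_exp_half_sq (a k)

/-- By homogeneity one may take `∑ a k ^ 2 = 1`, where powers are dominated by `cosh` and the
exponential moment is a constant. -/
lemma exists_sum_abs_rademacher_rpow_le {r : ℝ} (hr : 0 < r) :
    ∃ K : ℝ, 0 < K ∧ ∀ (m : ℕ) (a : Fin m → ℝ),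
      ∑ ε, |∑ k, rademacher k ε * a k| ^ r ≤ K * 2 ^ m * (∑ k, a k ^ 2) ^ (r / 2) := by
  obtain ⟨K, hK, h⟩ := exists_abs_rpow_le_cosh hr
  refine ⟨K * Real.exp (1 / 2), by positivity, fun m a => ?_⟩
  have hs0 : 0 ≤ ∑ k, a k ^ 2 := Finset.sum_nonneg fun k _ => sq_nonneg _
  rcases hs0.eq_or_lt with h0 | h0
  · have ha : ∀ k, a k = 0 := fun k => by
      have := (Finset.sum_eq_zero_iff_of_nonneg (fun k _ => sq_nonneg (a k))).1 h0.symm k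
        (Finset.mem_univ k)
      exact pow_eq_zero_iff (two_ne_zero) |>.1 this
    simp [ha, Real.zero_rpow hr.ne', Real.zero_rpow (div_pos hr two_pos).ne']
  set σ := Real.sqrt (∑ k, a k ^ 2) with hσ
  have hσ0 : 0 < σ := Real.sqrt_pos.2 h0
  have hσ2 : σ ^ 2 = ∑ k, a k ^ 2 := Real.sq_sqrt hs0
  have h1 : ∑ k, (a k / σ) ^ 2 = 1 := by
    simp_rw [div_pow]
    rw [← Finset.sum_div, hσ2, div_self h0.ne']
  have h2 : ∀ ε, |∑ k, rademacher k ε * a k| ^ r =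
      σ ^ r * |∑ k, rademacher k ε * (a k / σ)| ^ r := fun ε => by
    rw [← Real.mul_rpow hσ0.le (abs_nonneg _)]
    congr 1
    rw [← abs_of_pos hσ0, ← abs_mul, abs_of_pos hσ0, Finset.mul_sum]
    congr 1
    exact Finset.sum_congr rfl fun k _ => by field_simp
  have h3 : σ ^ r = (∑ k, a k ^ 2) ^ (r / 2) := by
    rw [← hσ2, ← Real.rpow_natCast, ← Real.rpow_mul hσ0.le]; congr 1; push_cast; ring
  calc ∑ ε, |∑ k, rademacher k ε * a k| ^ r
      = σ ^ r * ∑ ε, |∑ k, rademacher k ε * (a k / σ)| ^ r := by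
        rw [Finset.mul_sum]; exact Finset.sum_congr rfl fun ε _ => h2 ε
    _ ≤ σ ^ r * ∑ ε, K * Real.cosh (∑ k, rademacher k ε * (a k / σ)) := by
        gcongr with ε; exact h _
    _ ≤ σ ^ r * (K * (2 ^ m * Real.exp ((∑ k, (a k / σ) ^ 2) / 2))) := by
        rw [← Finset.mul_sum]; gcongr; exact sum_cosh_rademacher_le _
    _ = _ := by rw [h1, h3]; ring

variable (𝕜 : Type*) [RCLike 𝕜]

/-- Khinchin's inequality, upper bound. -/
lemma exists_sum_norm_rademacher_rpow_le {r : ℝ} (hr : 0 < r) :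
    ∃ K : ℝ, 0 < K ∧ ∀ (m : ℕ) (a : Fin m → 𝕜),
      ∑ ε, ‖∑ k, (rademacher k ε : 𝕜) * a k‖ ^ r ≤ K * 2 ^ m * (∑ k, ‖a k‖ ^ 2) ^ (r / 2) := by
  obtain ⟨K, hK, h⟩ := exists_sum_abs_rademacher_rpow_le hr
  refine ⟨2 ^ r * (2 * K), by positivity, fun m a => ?_⟩
  have hadd : ∀ x y : ℝ, 0 ≤ x → 0 ≤ y → (x + y) ^ r ≤ 2 ^ r * (x ^ r + y ^ r) := by
    intro x y hx hy
    rcases le_total x y with hxy | hxy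
    · calc (x + y) ^ r ≤ (2 * y) ^ r := by gcongr; linarith
        _ = 2 ^ r * y ^ r := Real.mul_rpow (by norm_num) hy
        _ ≤ _ := by gcongr; linarith [Real.rpow_nonneg hx r]
    · calc (x + y) ^ r ≤ (2 * x) ^ r := by gcongr; linarith
        _ = 2 ^ r * x ^ r := Real.mul_rpow (by norm_num) hx
        _ ≤ _ := by gcongr; linarith [Real.rpow_nonneg hy r]
  have h1 : ∀ ε, ‖∑ k, (rademacher k ε : 𝕜) * a k‖ ^ r ≤
      2 ^ r * (|∑ k, rademacher k ε * RCLike.re (a k)| ^ r +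
        |∑ k, rademacher k ε * RCLike.im (a k)| ^ r) := fun ε => by
    refine le_trans ?_ (hadd _ _ (abs_nonneg _) (abs_nonneg _))
    gcongr
    set z := ∑ k, (rademacher k ε : 𝕜) * a k with hz
    have h1 : ∑ k, rademacher k ε * RCLike.re (a k) = RCLike.re z := by
      simp only [hz, map_sum, RCLike.re_ofReal_mul]
    have h2 : ∑ k, rademacher k ε * RCLike.im (a k) = RCLike.im z := by
      simp only [hz, map_sum, RCLike.im_ofReal_mul]
    rw [h1, h2]
    refine abs_le_of_sq_le_sq' ?_ (by positivity) |>.2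
    rw [← RCLike.normSq_eq_def', RCLike.normSq_apply]
    nlinarith [abs_mul_abs_self (RCLike.re z), abs_mul_abs_self (RCLike.im z),
      mul_nonneg (abs_nonneg (RCLike.re z)) (abs_nonneg (RCLike.im z))]
  have hre : ∀ k, RCLike.re (a k) ^ 2 ≤ ‖a k‖ ^ 2 := fun k =>
    sq_le_sq.2 (by rw [abs_norm]; exact RCLike.abs_re_le_norm _)
  have him : ∀ k, RCLike.im (a k) ^ 2 ≤ ‖a k‖ ^ 2 := fun k =>
    sq_le_sq.2 (by rw [abs_norm]; exact RCLike.abs_im_le_norm _)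
  calc _ ≤ ∑ ε : Fin m → Bool, 2 ^ r * (|∑ k, rademacher k ε * RCLike.re (a k)| ^ r +
        |∑ k, rademacher k ε * RCLike.im (a k)| ^ r) := Finset.sum_le_sum fun ε _ => h1 ε
    _ ≤ 2 ^ r * (K * 2 ^ m * (∑ k, RCLike.re (a k) ^ 2) ^ (r / 2) +
        K * 2 ^ m * (∑ k, RCLike.im (a k) ^ 2) ^ (r / 2)) := by
        rw [← Finset.mul_sum, Finset.sum_add_distrib]
        gcongr
        · exact h m _
        · exact h m _
    _ ≤ 2 ^ r * (K * 2 ^ m * (∑ k, ‖a k‖ ^ 2) ^ (r / 2) +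
        K * 2 ^ m * (∑ k, ‖a k‖ ^ 2) ^ (r / 2)) := by
        have h1 : 0 ≤ ∑ k, RCLike.re (a k) ^ 2 := Finset.sum_nonneg fun k _ => sq_nonneg _
        have h2 : 0 ≤ ∑ k, RCLike.im (a k) ^ 2 := Finset.sum_nonneg fun k _ => sq_nonneg _
        have h3 : ∑ k, RCLike.re (a k) ^ 2 ≤ ∑ k, ‖a k‖ ^ 2 := Finset.sum_le_sum fun k _ => hre k
        have h4 : ∑ k, RCLike.im (a k) ^ 2 ≤ ∑ k, ‖a k‖ ^ 2 := Finset.sum_le_sum fun k _ => him k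
        gcongr
    _ = _ := by ring

/-- Khinchin's inequality, lower bound. -/
lemma exists_le_sum_norm_rademacher_rpow {r : ℝ} (hr : 0 < r) (hr2 : r < 2) :
    ∃ K : ℝ, 0 < K ∧ ∀ (m : ℕ) (a : Fin m → 𝕜),
      2 ^ m * (∑ k, ‖a k‖ ^ 2) ^ (r / 2) ≤ K * ∑ ε, ‖∑ k, (rademacher k ε : 𝕜) * a k‖ ^ r := by
  obtain ⟨K, hK, h⟩ := exists_sum_norm_rademacher_rpow_le 𝕜 (r := 4) (by norm_num)
  refine ⟨2 * (2 * K) ^ ((2 - r) / 2), by positivity, fun m a => ?_⟩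
  set S := ∑ k, ‖a k‖ ^ 2 with hS
  have hS0 : 0 ≤ S := Finset.sum_nonneg fun k _ => sq_nonneg _
  rcases hS0.eq_or_lt with h0 | h0
  · rw [← h0, Real.zero_rpow (div_pos hr two_pos).ne', mul_zero]
    positivity
  -- Below the threshold `2 * K * S` for `y ^ 2` the `r`-th power controls `y ^ 2`, above it the
  -- fourth power does. The threshold makes the fourth moment account for at most half of the
  -- exactly known second moment.
  have hpt : ∀ y : ℝ, 0 ≤ y → y ^ 2 ≤ (2 * K * S) ^ ((2 - r) / 2) * y ^ r +
      (2 * K * S)⁻¹ * y ^ (4 : ℝ) := by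
    intro y hy
    have hL : 0 < 2 * K * S := by positivity
    have h4 : y ^ (4 : ℝ) = y ^ 2 * y ^ 2 := by
      rw [← pow_add, ← Real.rpow_natCast]; norm_num
    rcases le_or_gt (y ^ 2) (2 * K * S) with hle | hgt
    · have : y ^ 2 ≤ (2 * K * S) ^ ((2 - r) / 2) * y ^ r := by
        rcases hy.eq_or_lt with rfl | hy0
        · simp [Real.zero_rpow hr.ne']
        calc y ^ 2 = (y ^ 2) ^ ((2 - r) / 2) * y ^ r := by
              rw [← Real.rpow_natCast, ← Real.rpow_mul hy, ← Real.rpow_add hy0]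
              congr 1; push_cast; ring
          _ ≤ _ := by gcongr
      have : 0 ≤ (2 * K * S)⁻¹ * y ^ (4 : ℝ) := by positivity
      linarith
    · have : y ^ 2 ≤ (2 * K * S)⁻¹ * y ^ (4 : ℝ) := by
        rw [h4, inv_mul_eq_div, le_div_iff₀ hL]
        nlinarith [sq_nonneg y]
      have : 0 ≤ (2 * K * S) ^ ((2 - r) / 2) * y ^ r := by positivity
      linarith
  have h2 := sum_norm_sq_rademacher (𝕜 := 𝕜) a
  simp only [smul_eq_mul] at h2
  have h3 : 2 ^ m * S ≤ (2 * K * S) ^ ((2 - r) / 2) *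
      ∑ ε, ‖∑ k, (rademacher k ε : 𝕜) * a k‖ ^ r + (2 * K * S)⁻¹ * (K * 2 ^ m * S ^ (2 : ℝ)) := by
    rw [← h2]
    have h4 := h m a
    rw [show (4 / 2 : ℝ) = 2 by norm_num, ← hS] at h4
    calc _ ≤ ∑ ε : Fin m → Bool, ((2 * K * S) ^ ((2 - r) / 2) *
          ‖∑ k, (rademacher k ε : 𝕜) * a k‖ ^ r + (2 * K * S)⁻¹ *
            ‖∑ k, (rademacher k ε : 𝕜) * a k‖ ^ (4 : ℝ)) :=
          Finset.sum_le_sum fun ε _ => hpt _ (norm_nonneg _)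
      _ ≤ _ := by
          rw [Finset.sum_add_distrib, ← Finset.mul_sum, ← Finset.mul_sum]
          gcongr
  have h5 : (2 * K * S)⁻¹ * (K * 2 ^ m * S ^ (2 : ℝ)) = 2 ^ m * S / 2 := by
    rw [Real.rpow_two]; field_simp
  rw [h5, Real.mul_rpow (by positivity) hS0] at h3
  have h6 : S = S ^ (r / 2) * S ^ ((2 - r) / 2) := by
    rw [← Real.rpow_add h0]
    conv_lhs => rw [← Real.rpow_one S]
    congr 1; ring
  have h7 : 0 < S ^ ((2 - r) / 2) := by positivity
  refine le_of_mul_le_mul_right ?_ h7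
  calc _ = 2 ^ m * S := by rw [mul_assoc, ← h6]
    _ ≤ _ := by linarith

/-- The Rademacher coefficients of an `L^p` function are square summable. -/
lemma exists_sum_norm_sq_rademacher_coeff_le {p p' : ℝ} (hpp' : p.HolderConjugate p') :
    ∃ K : ℝ, 0 < K ∧ ∀ (m : ℕ) (x : (Fin m → Bool) → 𝕜),
      ∑ k, ‖∑ ε, (rademacher k ε : 𝕜) * x ε‖ ^ 2 ≤
        K * (2 ^ m) ^ (2 / p') * (∑ ε, ‖x ε‖ ^ p) ^ (2 / p) := by
  obtain ⟨K, hK, h⟩ := exists_sum_norm_rademacher_rpow_le 𝕜 hpp'.symm.pos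
  have hp := hpp'.pos
  have hp' := hpp'.symm.pos
  refine ⟨K ^ (2 / p'), by positivity, fun m x => ?_⟩
  set c : Fin m → 𝕜 := fun k => ∑ ε, (rademacher k ε : 𝕜) * x ε with hc
  set S := ∑ k, ‖c k‖ ^ 2 with hS
  have hS0 : 0 ≤ S := Finset.sum_nonneg fun k _ => sq_nonneg _
  -- Duality: `S` is the pairing of `x` with a Rademacher sum whose `ℓ^p'` norm is bounded by
  -- Khinchin. Hölder then leaves a factor `S ^ (1/2)` to cancel.
  have h1 : (S : 𝕜) = ∑ ε, x ε * ∑ k, (rademacher k ε : 𝕜) * star (c k) := by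
    have : ∀ k, ((‖c k‖ ^ 2 : ℝ) : 𝕜) = ∑ ε, x ε * ((rademacher k ε : 𝕜) * star (c k)) := by
      intro k
      have h2 : ((‖c k‖ ^ 2 : ℝ) : 𝕜) = c k * star (c k) := by
        push_cast
        exact (RCLike.mul_conj (c k)).symm
      rw [h2]
      nth_rewrite 1 [hc]
      simp only
      rw [Finset.sum_mul]
      exact Finset.sum_congr rfl fun ε _ => by ring
    rw [hS]
    push_cast
    push_cast at this
    simp_rw [this, Finset.mul_sum]
    rw [Finset.sum_comm]
  have h2 : S ≤ (∑ ε, ‖x ε‖ ^ p) ^ (1 / p) * (K * 2 ^ m * S ^ (p' / 2)) ^ (1 / p') := by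
    have e : S = ‖(S : 𝕜)‖ := by rw [RCLike.norm_ofReal, abs_of_nonneg hS0]
    have h3 := Real.inner_le_Lp_mul_Lq Finset.univ (fun ε => ‖x ε‖)
      (fun ε => ‖∑ k, (rademacher k ε : 𝕜) * star (c k)‖) hpp'
    simp only [abs_norm] at h3
    have h4 := h m fun k => star (c k)
    simp only [norm_star] at h4
    calc S ≤ ∑ ε, ‖x ε‖ * ‖∑ k, (rademacher k ε : 𝕜) * star (c k)‖ := by
          conv_lhs => rw [e, h1]
          refine (norm_sum_le _ _).trans (le_of_eq ?_)
          exact Finset.sum_congr rfl fun ε _ => norm_mul _ _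
      _ ≤ _ := h3
      _ ≤ _ := by gcongr
  rcases hS0.eq_or_lt with h0 | h0
  · rw [← h0]; positivity
  have hX : 0 ≤ ∑ ε, ‖x ε‖ ^ p := Finset.sum_nonneg fun ε _ => by positivity
  have h3 : (K * 2 ^ m * S ^ (p' / 2)) ^ (1 / p') =
      K ^ (1 / p') * (2 ^ m) ^ (1 / p') * S ^ (1 / 2 : ℝ) := by
    rw [Real.mul_rpow (by positivity) (by positivity),
      Real.mul_rpow (by positivity) (by positivity),
      ← Real.rpow_mul hS0]
    congr 2
    field_simp
  rw [h3] at h2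
  have h4 : S = S ^ (1 / 2 : ℝ) * S ^ (1 / 2 : ℝ) := by
    rw [← Real.rpow_add h0]; norm_num
  have h5 : S ^ (1 / 2 : ℝ) ≤ (∑ ε, ‖x ε‖ ^ p) ^ (1 / p) * (K ^ (1 / p') * (2 ^ m) ^ (1 / p')) := by
    refine le_of_mul_le_mul_right ?_ (by positivity : 0 < S ^ (1 / 2 : ℝ))
    rw [← h4]; linarith
  have hsq : ∀ (y q : ℝ), 0 ≤ y → y ^ (2 / q) = (y ^ (1 / q)) ^ 2 := fun y q hy => by
    rw [← Real.rpow_natCast, ← Real.rpow_mul hy]; congr 1; push_cast; ring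
  rw [hsq _ _ hK.le, hsq _ _ (by positivity), hsq _ _ hX]
  calc S = (S ^ (1 / 2 : ℝ)) ^ 2 := by rw [sq]; exact h4
    _ ≤ _ := pow_le_pow_left₀ (by positivity) h5 2
    _ = _ := by ring

end Khinchin

/-! ### The Walsh operator and its decay on Rademacher averages -/

section WalshOperator

/-- The disjoint union of the discrete cubes `{0,1}^n`. -/
abbrev Cubes : Type := Σ n : ℕ, (Fin n → Bool)

variable {𝕜 : Type*} [RCLike 𝕜] {p p' : ℝ≥0∞} [Fact (1 ≤ p)] [Fact (1 ≤ p')]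

lemma two_lt_of_holderConjugate {r r' : ℝ} (h : r.HolderConjugate r') (h2 : r < 2) : 2 < r' := by
  have h1 : (r - 1) * r' = r := h.sub_one_mul_conj
  have h3 := h.lt
  have h4 := h.symm.lt
  nlinarith

/-- The constant in the Hausdorff–Young inequality. -/
noncomputable def hausdorffYoungConst (r : ℝ) : ℝ := 4 * (r / (r - 2)) * 2 ^ (r - 2)

lemma hausdorffYoungConst_pos {r : ℝ} (hr : 2 < r) : 0 < hausdorffYoungConst r := by
  have : 0 < r - 2 := by linarith
  unfold hausdorffYoungConst
  positivity

lemma sum_norm_walsh_rpow_le {H : Type*} [NormedAddCommGroup H] [InnerProductSpace 𝕜 H] {r r' : ℝ}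
    (h2 : r < 2) (h : r.HolderConjugate r') {n : ℕ} {x : (Fin n → Bool) → H}
    {s w : ℝ} (hs : 0 ≤ s) (hw : 0 < w) (hxs : ∑ ω, ‖x ω‖ ^ r ≤ s ^ r)
    (hxw : ∀ a : H, ∑ ω, ‖inner 𝕜 a (x ω)‖ ^ r ≤ (w * ‖a‖) ^ r) :
    ∑ A, ‖∑ ω, (walsh A ω : 𝕜) • x ω‖ ^ r' ≤
      hausdorffYoungConst r' * 2 ^ n * w ^ (r' - 2) * s ^ 2 :=
  sum_norm_rpow_le_of_weak_strong (k := fun A ω => (walsh A ω : 𝕜))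
    (fun A ω => by rw [RCLike.norm_ofReal, abs_walsh]) (by positivity)
    (fun y => (sum_norm_sq_walsh y).le) h.lt h2 h hs hw hxs hxw

/-- For scalars the weak and strong norms agree, so `s = w` recovers the classical inequality up to
the constant. -/
lemma sum_norm_walsh_mul_rpow_le {r r' : ℝ} (h2 : r < 2) (h : r.HolderConjugate r') {n : ℕ}
    (x : (Fin n → Bool) → 𝕜) :
    ∑ A, ‖∑ ω, (walsh A ω : 𝕜) * x ω‖ ^ r' ≤
      hausdorffYoungConst r' * 2 ^ n * (∑ ω, ‖x ω‖ ^ r) ^ (r' / r) := by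
  have hr := h.pos
  have hr' := h.symm.pos
  have hS : 0 ≤ ∑ ω, ‖x ω‖ ^ r := Finset.sum_nonneg fun ω _ => by positivity
  rcases hS.eq_or_lt with h0 | h0
  · have hx : ∀ ω, x ω = 0 := fun ω => by
      have := (Finset.sum_eq_zero_iff_of_nonneg (fun ω _ => by positivity)).1 h0.symm ω
        (Finset.mem_univ ω)
      rwa [Real.rpow_eq_zero (norm_nonneg _) hr.ne', norm_eq_zero] at this
    simp [hx, Real.zero_rpow hr'.ne', Real.zero_rpow hr.ne', Real.zero_rpow (div_pos hr' hr).ne']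
  set s := (∑ ω, ‖x ω‖ ^ r) ^ (1 / r) with hs
  have hs0 : 0 < s := by positivity
  have hsr : s ^ r = ∑ ω, ‖x ω‖ ^ r := by
    rw [hs, ← Real.rpow_mul hS, one_div_mul_cancel hr.ne', Real.rpow_one]
  have := sum_norm_walsh_rpow_le (𝕜 := 𝕜) h2 h (x := x) hs0.le hs0 hsr.ge fun a => by
    rw [Real.mul_rpow hs0.le (norm_nonneg a), hsr, Finset.sum_mul]
    refine Finset.sum_le_sum fun ω _ => ?_
    rw [← Real.mul_rpow (norm_nonneg _) (norm_nonneg _), mul_comm]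
    gcongr
    exact norm_inner_le_norm a (x ω)
  refine this.trans (le_of_eq ?_)
  rw [mul_assoc _ (s ^ (r' - 2)), ← Real.rpow_natCast s 2, ← Real.rpow_add hs0, hs,
    ← Real.rpow_mul hS]
  rw [Nat.cast_ofNat, sub_add_cancel, one_div_mul_eq_div]

/-- The direct sum of the normalized Walsh transforms, as an operator `ℓ^p → ℓ^p'`. -/
noncomputable def walshOp (𝕜 : Type*) [RCLike 𝕜] {p p' : ℝ≥0∞} [Fact (1 ≤ p)] [Fact (1 ≤ p')]
    (h2 : p.toReal < 2) (h : p.toReal.HolderConjugate p'.toReal) :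
    lp (fun _ : Cubes => 𝕜) p →L[𝕜] lp (fun _ : Cubes => 𝕜) p' :=
  lpCLM p' (fun i => (((2 ^ i.1 : ℝ) ^ (-(1 / p'.toReal)) : ℝ) : 𝕜) •
      ∑ ω, (walsh i.2 ω : 𝕜) • lp.evalCLM 𝕜 (fun _ : Cubes => 𝕜) p ⟨i.1, ω⟩) fun x => by
    have hp' := h.symm.pos
    have hlt := two_lt_of_holderConjugate h h2
    refine memℓp_block h.pos (by linarith) x (hausdorffYoungConst p'.toReal) fun n => ?_
    have h1 := sum_norm_walsh_mul_rpow_le h2 h fun ω => x ⟨n, ω⟩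
    have h3 : ((2 ^ n : ℝ) ^ (-(1 / p'.toReal))) ^ p'.toReal = (2 ^ n)⁻¹ := by
      rw [← Real.rpow_mul (by positivity), neg_mul, one_div_mul_cancel hp'.ne', Real.rpow_neg_one]
    calc _ = (2 ^ n)⁻¹ * ∑ A, ‖∑ ω, (walsh A ω : 𝕜) * x ⟨n, ω⟩‖ ^ p'.toReal := by
          rw [Finset.mul_sum]
          refine Finset.sum_congr rfl fun A _ => ?_
          simp only [smul_apply, sum_apply, smul_eq_mul,
            norm_mul, RCLike.norm_ofReal]
          rw [Real.mul_rpow (abs_nonneg _) (norm_nonneg _), abs_of_nonneg (by positivity), h3]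
          rfl
      _ ≤ (2 ^ n)⁻¹ * (hausdorffYoungConst p'.toReal * 2 ^ n *
            (∑ ω, ‖x ⟨n, ω⟩‖ ^ p.toReal) ^ (p'.toReal / p.toReal)) := by gcongr
      _ = _ := by field_simp

lemma walshOp_apply (h2 : p.toReal < 2) (h : p.toReal.HolderConjugate p'.toReal)
    (x : lp (fun _ : Cubes => 𝕜) p) (n : ℕ) (A : Fin n → Bool) :
    walshOp 𝕜 h2 h x ⟨n, A⟩ = (((2 ^ n : ℝ) ^ (-(1 / p'.toReal)) : ℝ) : 𝕜) *
      ∑ ω, (walsh A ω : 𝕜) * x ⟨n, ω⟩ := by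
  simp only [walshOp, lpCLM_apply, smul_apply, sum_apply,
    smul_eq_mul]
  rfl

lemma norm_walshOp_rpow (h2 : p.toReal < 2) (h : p.toReal.HolderConjugate p'.toReal)
    (x : lp (fun _ : Cubes => 𝕜) p) (n : ℕ) (A : Fin n → Bool) :
    ‖walshOp 𝕜 h2 h x ⟨n, A⟩‖ ^ p'.toReal =
      (2 ^ n)⁻¹ * ‖∑ ω, (walsh A ω : 𝕜) * x ⟨n, ω⟩‖ ^ p'.toReal := by
  have hp' := h.symm.pos
  rw [walshOp_apply, norm_mul, RCLike.norm_ofReal, Real.mul_rpow (abs_nonneg _) (norm_nonneg _),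
    abs_of_nonneg (by positivity), ← Real.rpow_mul (by positivity), neg_mul,
    one_div_mul_cancel hp'.ne', Real.rpow_neg_one]

/-- The Rademacher averages of an `m`-dimensional Hilbertian family in `ℓ^p` are mapped by the Walsh
operator to vectors of size `m ^ (1/p')`. -/
theorem exists_sum_norm_walshOp_rpow_le (h2 : p.toReal < 2)
    (h : p.toReal.HolderConjugate p'.toReal) :
    ∃ K : ℝ, 0 < K ∧ ∀ (m : ℕ) (v : Fin m → lp (fun _ : Cubes => 𝕜) p) (C : ℝ), 0 < C →
      (∀ a : Fin m → 𝕜, ‖∑ k, a k • v k‖ ≤ C * (∑ k, ‖a k‖ ^ 2) ^ (1 / 2 : ℝ)) →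
      ∑ ε, ‖walshOp 𝕜 h2 h (∑ k, (rademacher k ε : 𝕜) • v k)‖ ^ p'.toReal ≤
        K * 2 ^ m * C ^ p'.toReal * m := by
  obtain ⟨K₁, hK₁, lower⟩ := exists_le_sum_norm_rademacher_rpow 𝕜 h.pos h2
  obtain ⟨K₂, hK₂, upper⟩ := exists_sum_norm_rademacher_rpow_le 𝕜 h.symm.pos
  set r := p.toReal with hr
  set r' := p'.toReal with hr'
  have hr0 : 0 < r := h.pos
  have hr'0 : 0 < r' := h.symm.pos
  have hlt : 2 < r' := two_lt_of_holderConjugate h h2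
  have hK := hausdorffYoungConst_pos hlt
  refine ⟨K₂ * hausdorffYoungConst r' * K₁ ^ (2 / r), by positivity, fun m v C hC hv => ?_⟩
  set V : (Fin m → Bool) → lp (fun _ : Cubes => 𝕜) p := fun ε => ∑ k, (rademacher k ε : 𝕜) • v k
    with hV
  have sum_apply : ∀ (a : Fin m → 𝕜) (i : Cubes), (∑ k, a k • v k) i = ∑ k, a k * v k i :=
    fun a i => by rw [lp.coeFn_sum, Finset.sum_apply]; rfl
  -- The family is read as a single function with values in `ℓ_2^m`. The conjugation makes `inner a
  -- (X i)` the conjugate of the `i`-th coordinate of `∑ a k • v k`.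
  set X : Cubes → EuclideanSpace 𝕜 (Fin m) := fun i => WithLp.toLp 2 fun k => star (v k i) with hX
  have normX : ∀ z : EuclideanSpace 𝕜 (Fin m), ∀ q : ℝ,
      ‖z‖ ^ q = (∑ k, ‖z k‖ ^ 2) ^ (q / 2) := fun z q => by
    rw [← EuclideanSpace.norm_sq_eq, ← Real.rpow_natCast, ← Real.rpow_mul (norm_nonneg _)]
    congr 1; push_cast; ring
  -- `τ n` is, up to the Khinchin constant, the Rademacher average of the `p`-th powers on block
  -- `n`; it serves as the strong norm to the power `p`.
  set τ : ℕ → ℝ := fun n => K₁ * (2 ^ m)⁻¹ * ∑ ε, ∑ ω : Fin n → Bool, ‖V ε ⟨n, ω⟩‖ ^ r with hτ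
  have hτ0 : ∀ n, 0 ≤ τ n := fun n => by positivity
  set T : ℝ := K₁ * (2 ^ m)⁻¹ * ∑ ε, ‖V ε‖ ^ r with hT
  have hsum : HasSum τ T := (hasSum_sum fun ε _ => hasSum_block_norm hr0 (V ε)).mul_left _
  have hT0 : 0 ≤ T := by positivity
  have hTle : T ≤ K₁ * (C ^ r * (m : ℝ) ^ (r / 2)) := by
    have h1 : ∀ ε, ‖V ε‖ ^ r ≤ C ^ r * (m : ℝ) ^ (r / 2) := fun ε => by
      have h3 := hv fun k => (rademacher k ε : 𝕜)
      simp only [RCLike.norm_ofReal, abs_rademacher, one_pow, Finset.sum_const,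
        Finset.card_univ, Fintype.card_fin, nsmul_eq_mul, mul_one] at h3
      calc ‖V ε‖ ^ r ≤ (C * (m : ℝ) ^ (1 / 2 : ℝ)) ^ r := by gcongr
        _ = _ := by
          rw [Real.mul_rpow hC.le (by positivity), ← Real.rpow_mul (by positivity)]
          congr 2; ring
    calc T ≤ K₁ * (2 ^ m)⁻¹ * ∑ _ε : Fin m → Bool, C ^ r * (m : ℝ) ^ (r / 2) := by
          rw [hT]; gcongr with ε; exact h1 ε
      _ = _ := by simp; field_simp
  have strong : ∀ n, ∑ ω : Fin n → Bool, ‖X ⟨n, ω⟩‖ ^ r ≤ τ n := fun n => by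
    calc ∑ ω : Fin n → Bool, ‖X ⟨n, ω⟩‖ ^ r
        ≤ ∑ ω : Fin n → Bool, K₁ * (2 ^ m)⁻¹ * ∑ ε, ‖V ε ⟨n, ω⟩‖ ^ r := by
          refine Finset.sum_le_sum fun ω _ => ?_
          have h1 := lower m fun k => v k ⟨n, ω⟩
          rw [normX, mul_comm K₁, mul_assoc, ← div_eq_inv_mul, le_div_iff₀' (by positivity)]
          simp only [hX, norm_star]
          simpa only [hV, sum_apply] using h1
      _ = τ n := by rw [← Finset.mul_sum, Finset.sum_comm]
  -- The weak norm of `X` on a block is at most the constant `C` of the upper `ℓ_2^m` estimate,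
  -- independently of `m` and `n`.
  have weak : ∀ n, ∀ a : EuclideanSpace 𝕜 (Fin m),
      ∑ ω : Fin n → Bool, ‖inner 𝕜 a (X ⟨n, ω⟩)‖ ^ r ≤ (C * ‖a‖) ^ r := fun n a => by
    have h1 : ∀ ω : Fin n → Bool, ‖inner 𝕜 a (X ⟨n, ω⟩)‖ = ‖(∑ k, a k • v k) ⟨n, ω⟩‖ := fun ω => by
      rw [sum_apply, PiLp.inner_apply, ← norm_star, star_sum]
      congr 1
      refine Finset.sum_congr rfl fun k _ => ?_
      simp [hX, mul_comm]
    simp_rw [h1]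
    have h3 : ∑ ω : Fin n → Bool, ‖(∑ k, a k • v k) ⟨n, ω⟩‖ ^ r ≤ ‖∑ k, a k • v k‖ ^ r :=
      le_hasSum (hasSum_block_norm hr0 (∑ k, a k • v k)) n fun _ _ => by positivity
    refine h3.trans ?_
    have h4 : ‖a‖ = (∑ k, ‖a k‖ ^ 2) ^ (1 / 2 : ℝ) := by rw [← normX, Real.rpow_one]
    rw [h4]
    gcongr
    exact hv a
  have block : ∀ n, ∑ ε, ∑ A : Fin n → Bool, ‖walshOp 𝕜 h2 h (V ε) ⟨n, A⟩‖ ^ r' ≤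
      K₂ * 2 ^ m * hausdorffYoungConst r' * C ^ (r' - 2) * T ^ (2 / r - 1) * τ n := fun n => by
    have h1 : ∀ A : Fin n → Bool, ∑ ε, ‖∑ ω, (walsh A ω : 𝕜) * V ε ⟨n, ω⟩‖ ^ r' ≤
        K₂ * 2 ^ m * ‖∑ ω, (walsh A ω : 𝕜) • X ⟨n, ω⟩‖ ^ r' := fun A => by
      have h3 := upper m fun k => ∑ ω, (walsh A ω : 𝕜) * v k ⟨n, ω⟩
      rw [normX]
      have h4 : ∀ k, ‖(∑ ω, (walsh A ω : 𝕜) • X ⟨n, ω⟩) k‖ =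
          ‖∑ ω, (walsh A ω : 𝕜) * v k ⟨n, ω⟩‖ := fun k => by
        rw [← norm_star]
        congr 1
        simp [hX, RCLike.real_smul_eq_coe_mul]
      simp_rw [h4]
      refine le_trans (le_of_eq ?_) h3
      refine Finset.sum_congr rfl fun ε _ => ?_
      congr 2
      simp only [hV, sum_apply, Finset.mul_sum]
      rw [Finset.sum_comm]
      exact Finset.sum_congr rfl fun k _ => Finset.sum_congr rfl fun ω _ => by ring
    have hs : (τ n ^ (1 / r)) ^ r = τ n := by
      rw [← Real.rpow_mul (hτ0 n), one_div_mul_cancel hr0.ne', Real.rpow_one]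
    have h3 := sum_norm_walsh_rpow_le (𝕜 := 𝕜) h2 h (x := fun ω => X ⟨n, ω⟩)
      (s := τ n ^ (1 / r)) (w := C) (by have := hτ0 n; positivity) hC (by rw [hs]; exact strong n)
      (weak n)
    -- The strong norm enters squared, as `τ n ^ (2 / r)` with `2 / r ≥ 1`. A bound linear in `τ n`
    -- follows, and this can be summed over the blocks.
    have h4 : (τ n ^ (1 / r)) ^ 2 = τ n ^ (2 / r) := by
      rw [← Real.rpow_natCast, ← Real.rpow_mul (hτ0 n)]; congr 1; push_cast; ring
    have h5 : τ n ^ (2 / r) ≤ T ^ (2 / r - 1) * τ n :=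
      rpow_le_of_hasSum hτ0 hsum ((one_le_div hr0).2 h2.le) n
    rw [h4] at h3
    calc ∑ ε, ∑ A : Fin n → Bool, ‖walshOp 𝕜 h2 h (V ε) ⟨n, A⟩‖ ^ r'
        = (2 ^ n)⁻¹ * ∑ A : Fin n → Bool, ∑ ε, ‖∑ ω, (walsh A ω : 𝕜) * V ε ⟨n, ω⟩‖ ^ r' := by
          simp_rw [hr', norm_walshOp_rpow, Finset.mul_sum]
          rw [Finset.sum_comm]
      _ ≤ (2 ^ n)⁻¹ * (K₂ * 2 ^ m * (hausdorffYoungConst r' * 2 ^ n * C ^ (r' - 2) *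
            (T ^ (2 / r - 1) * τ n))) := by
          gcongr
          refine (Finset.sum_le_sum fun A _ => h1 A).trans ?_
          rw [← Finset.mul_sum]
          gcongr
          refine h3.trans ?_
          gcongr
      _ = _ := by field_simp
  have total := hasSum_le block
    (hasSum_sum fun ε _ => hasSum_block_norm hr'0 (walshOp 𝕜 h2 h (V ε))) (hsum.mul_left _)
  refine total.trans ?_
  -- `T` is of order `m ^ (r / 2)`, so `T ^ (2 / r)` is linear in `m`.
  have h1 : T ^ (2 / r - 1) * T ≤ K₁ ^ (2 / r) * (C ^ 2 * m) := by
    rcases hT0.eq_or_lt with h0 | h0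
    · rw [← h0, mul_zero]; positivity
    · have e : (K₁ * (C ^ r * (m : ℝ) ^ (r / 2))) ^ (2 / r) = K₁ ^ (2 / r) * (C ^ 2 * m) := by
        rw [Real.mul_rpow hK₁.le (by positivity), Real.mul_rpow (by positivity) (by positivity),
          ← Real.rpow_mul hC.le, ← Real.rpow_mul (by positivity), mul_div_cancel₀ _ hr0.ne',
          show r / 2 * (2 / r) = 1 by field_simp, Real.rpow_one, Real.rpow_two]
      rw [← e, ← Real.rpow_add_one h0.ne', sub_add_cancel]
      gcongr
  have h3 : C ^ r' = C ^ (r' - 2) * C ^ 2 := by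
    rw [← Real.rpow_natCast, ← Real.rpow_add hC]; congr 1; push_cast; ring
  calc K₂ * 2 ^ m * hausdorffYoungConst r' * C ^ (r' - 2) * T ^ (2 / r - 1) * T
      = K₂ * 2 ^ m * hausdorffYoungConst r' * C ^ (r' - 2) * (T ^ (2 / r - 1) * T) := by ring
    _ ≤ K₂ * 2 ^ m * hausdorffYoungConst r' * C ^ (r' - 2) * (K₁ ^ (2 / r) * (C ^ 2 * m)) := by
        gcongr
    _ = _ := by rw [h3]; ring

end WalshOperator

/-! ### Duality and reflexivity of `ℓ^p` -/

section Duality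

variable {𝕜 : Type*} [RCLike 𝕜] {ι : Type*} {p p' : ℝ≥0∞} [Fact (1 ≤ p)]

/-- The coefficients of a functional on `ℓ^p` form an element of `ℓ^p'`. -/
lemma memℓp_dual [DecidableEq ι] (h : p.toReal.HolderConjugate p'.toReal)
    (g : StrongDual 𝕜 (lp (fun _ : ι => 𝕜) p)) :
    Memℓp (fun i => g (lp.single p i (1 : 𝕜))) p' := by
  have hp := h.pos
  have hp' := h.symm.pos
  set r := p.toReal with hr
  set r' := p'.toReal with hr'
  refine memℓp_gen' (C := ‖g‖ ^ r') fun s => ?_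
  set γ : ι → 𝕜 := fun i => g (lp.single p i (1 : 𝕜)) with hγ
  set S := ∑ i ∈ s, ‖γ i‖ ^ r' with hS
  have hS0 : 0 ≤ S := Finset.sum_nonneg fun i _ => by positivity
  rcases hS0.eq_or_lt with h0 | h0
  · rw [← h0]; positivity
  -- The extremal vector for Hölder's inequality: `c i * γ i = ‖γ i‖ ^ r'` and `‖c i‖ ^ r = ‖γ i‖ ^
  -- r'`.
  set c : ι → 𝕜 := fun i => star (γ i) * ((‖γ i‖ ^ (r' - 2) : ℝ) : 𝕜) with hc
  have hcn : ∀ i, ‖c i‖ ^ r = ‖γ i‖ ^ r' := fun i => by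
    rw [hc]
    simp only [norm_mul, norm_star, RCLike.norm_ofReal]
    rw [abs_of_nonneg (by positivity)]
    rcases (norm_nonneg (γ i)).eq_or_lt with h1 | h1
    · rw [← h1, zero_mul, Real.zero_rpow hp.ne', Real.zero_rpow hp'.ne']
    · rw [← Real.rpow_one_add' h1.le (by have := h.symm.lt; linarith), ← Real.rpow_mul h1.le]
      congr 1
      have := h.symm.sub_one_mul_conj
      linarith
  have hcg : ∀ i, c i * γ i = ((‖γ i‖ ^ r' : ℝ) : 𝕜) := fun i => by
    rw [hc]
    simp only
    rw [mul_right_comm, RCLike.star_def, RCLike.conj_mul]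
    norm_cast
    rcases (norm_nonneg (γ i)).eq_or_lt with h1 | h1
    · rw [← h1, Real.zero_rpow hp'.ne']; simp
    · rw [← Real.rpow_natCast, ← Real.rpow_add h1]; congr 2; push_cast; ring
  have h1 : (S : 𝕜) = g (∑ i ∈ s, lp.single p i (c i)) := by
    rw [map_sum, hS]
    push_cast
    refine Finset.sum_congr rfl fun i _ => ?_
    have e : (lp.single p i (c i) : lp (fun _ : ι => 𝕜) p) = c i • lp.single p i (1 : 𝕜) := by
      rw [← lp.single_smul, smul_eq_mul, mul_one]
    rw [e, map_smul, smul_eq_mul, hcg]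
  have h2 : ‖∑ i ∈ s, lp.single p i (c i)‖ ^ r = S := by
    rw [hr, lp.norm_sum_single hp]
    exact Finset.sum_congr rfl fun i _ => hcn i
  have h3 : S ≤ ‖g‖ * S ^ (1 / r) := by
    calc S = ‖(S : 𝕜)‖ := by rw [RCLike.norm_ofReal, abs_of_nonneg hS0]
      _ ≤ ‖g‖ * ‖∑ i ∈ s, lp.single p i (c i)‖ := by rw [h1]; exact g.le_opNorm _
      _ = _ := by
        rw [← h2, ← Real.rpow_mul (norm_nonneg _), mul_one_div_cancel hp.ne', Real.rpow_one]
  have h4 : S = S ^ (1 / r') * S ^ (1 / r) := by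
    rw [← Real.rpow_add h0, one_div, one_div, h.symm.inv_add_inv_eq_one, Real.rpow_one]
  have h5 : S ^ (1 / r') ≤ ‖g‖ := by
    refine le_of_mul_le_mul_right ?_ (by positivity : 0 < S ^ (1 / r))
    rwa [← h4]
  calc S = (S ^ (1 / r')) ^ r' := by
        rw [← Real.rpow_mul hS0, one_div_mul_cancel hp'.ne', Real.rpow_one]
    _ ≤ _ := by gcongr

/-- The pairing of `ℓ^p'` with `ℓ^p`. -/
noncomputable def lpPairing (𝕜 : Type*) [RCLike 𝕜] (ι : Type*) (p p' : ℝ≥0∞) [Fact (1 ≤ p)]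
    [Fact (1 ≤ p')] [p'.HolderConjugate p] :
    lp (fun _ : ι => 𝕜) p' →L[𝕜] StrongDual 𝕜 (lp (fun _ : ι => 𝕜) p) :=
  lp.dualPairing p' p (fun _ => ContinuousLinearMap.mul 𝕜 𝕜) (K := 1) fun _ => by simp

variable [Fact (1 ≤ p')]

lemma lpPairing_apply [p'.HolderConjugate p] (y : lp (fun _ : ι => 𝕜) p')
    (x : lp (fun _ : ι => 𝕜) p) : lpPairing 𝕜 ι p p' y x = ∑' i, y i * x i := rfl

lemma lpPairing_single_right [DecidableEq ι] [p'.HolderConjugate p]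
    (y : lp (fun _ : ι => 𝕜) p') (i : ι) (c : 𝕜) :
    lpPairing 𝕜 ι p p' y (lp.single p i c) = y i * c := by
  rw [lpPairing_apply, tsum_eq_single i]
  · rw [lp.single_apply_self]
  · intro j hj; rw [lp.single_apply_ne _ _ _ hj, mul_zero]

/-- Every functional on `ℓ^p` comes from `ℓ^p'`. -/
lemma exists_lpPairing_eq [DecidableEq ι] [p'.HolderConjugate p] (hp : p ≠ ∞)
    (h : p.toReal.HolderConjugate p'.toReal) (g : StrongDual 𝕜 (lp (fun _ : ι => 𝕜) p)) :
    ∃ y : lp (fun _ : ι => 𝕜) p', lpPairing 𝕜 ι p p' y = g ∧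
      ∀ i, y i = g (lp.single p i (1 : 𝕜)) := by
  refine ⟨⟨_, memℓp_dual h g⟩, ?_, fun i => rfl⟩
  ext x
  have h1 := (lp.hasSum_single hp x).mapL g
  have h2 := (lp.hasSum_single hp x).mapL (lpPairing 𝕜 ι p p' ⟨_, memℓp_dual h g⟩)
  refine h2.unique ?_
  convert h1 using 2 with i
  have e : (lp.single p i (x i) : lp (fun _ : ι => 𝕜) p) = x i • lp.single p i (1 : 𝕜) := by
    rw [← lp.single_smul, smul_eq_mul, mul_one]
  rw [lpPairing_single_right, e, map_smul, smul_eq_mul, mul_comm]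

/-- `ℓ^p` is reflexive for `1 < p < ∞`. -/
theorem surjective_inclusionInDoubleDual_lp [p'.HolderConjugate p] (hp : p ≠ ∞) (hp' : p' ≠ ∞)
    (h : p.toReal.HolderConjugate p'.toReal) :
    Function.Surjective
      (NormedSpace.inclusionInDoubleDual 𝕜 (lp (fun _ : ι => 𝕜) p)) := by
  classical
  intro ξ
  have : p.HolderConjugate p' := ENNReal.HolderConjugate.symm
  obtain ⟨x, hx1, hx2⟩ := exists_lpPairing_eq hp' h.symm (ξ.comp (lpPairing 𝕜 ι p p'))
  refine ⟨x, ?_⟩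
  ext g
  obtain ⟨y, rfl, hy⟩ := exists_lpPairing_eq hp h g
  rw [NormedSpace.dual_def, ← ContinuousLinearMap.comp_apply, ← hx1, lpPairing_apply,
    lpPairing_apply]
  simp_rw [mul_comm]

end Duality

/-! ### Ideals defined by averages; pullback under transposition -/

section AverageIdeal
open Filter Topology

variable {𝕜 : Type*} [RCLike 𝕜] {Z : Type*} [NormedAddCommGroup Z] [NormedSpace 𝕜 Z]

/-- The average of the norms of the vectors `R (z ω)`. -/
noncomputable def avgNorm (z : ∀ n : ℕ, (Fin n → Bool) → Z) (R : Operators 𝕜 Z) (n : ℕ) : ℝ :=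
  (2 ^ n)⁻¹ * ∑ ω, ‖R (z n ω)‖

lemma avgNorm_nonneg (z : ∀ n : ℕ, (Fin n → Bool) → Z) (R : Operators 𝕜 Z) (n : ℕ) :
    0 ≤ avgNorm z R n := by unfold avgNorm; positivity

lemma avgNorm_le_of_forall_le {z : ∀ n : ℕ, (Fin n → Bool) → Z} {R : Operators 𝕜 Z} {n : ℕ} {C : ℝ}
    (h : ∀ ω, ‖R (z n ω)‖ ≤ C) : avgNorm z R n ≤ C := by
  rw [avgNorm, inv_mul_le_iff₀ (by positivity)]
  refine (Finset.sum_le_sum fun ω _ => h ω).trans (le_of_eq ?_)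
  simp

lemma le_avgNorm_of_forall_le {z : ∀ n : ℕ, (Fin n → Bool) → Z} {R : Operators 𝕜 Z} {n : ℕ} {C : ℝ}
    (h : ∀ ω, C ≤ ‖R (z n ω)‖) : C ≤ avgNorm z R n := by
  rw [avgNorm, le_inv_mul_iff₀ (by positivity)]
  refine le_trans (le_of_eq ?_) (Finset.sum_le_sum fun ω _ => h ω)
  simp

lemma avgNorm_add_le (z : ∀ n : ℕ, (Fin n → Bool) → Z) (R S : Operators 𝕜 Z) (n : ℕ) :
    avgNorm z (R + S) n ≤ avgNorm z R n + avgNorm z S n := by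
  unfold avgNorm
  rw [← mul_add, ← Finset.sum_add_distrib]
  gcongr with ω
  exact norm_add_le _ _

/-- The operators `R` such that, for each operator `B`, the operators `R B` tend to zero on average
along a bounded family of vectors form a closed ideal. -/
noncomputable def avgIdeal (z : ∀ n : ℕ, (Fin n → Bool) → Z) {C : ℝ}
    (hz : ∀ n ω, ‖z n ω‖ ≤ C) : ClosedIdeal 𝕜 Z :=
  -- Quantifying over `B` builds in stability under right multiplication, which averages along a
  -- fixed family would not provide.
  ⟨TwoSidedIdeal.mk' {R | ∀ B : Operators 𝕜 Z, Tendsto (avgNorm z (R * B)) atTop (𝓝 0)}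
    (fun B => by
      have : avgNorm z (0 * B) = fun _ => 0 := by funext n; simp [avgNorm]
      rw [this]
      exact tendsto_const_nhds)
    (fun {R S} hR hS B => by
      refine squeeze_zero (avgNorm_nonneg z _) (fun n => ?_) (by simpa using (hR B).add (hS B))
      rw [add_mul]
      exact avgNorm_add_le z _ _ n)
    (fun {R} hR B => by
      refine (hR B).congr fun n => ?_
      simp [avgNorm, neg_mul])
    (fun {R S} hS B => by
      refine squeeze_zero (avgNorm_nonneg z _) (fun n => ?_)
        (by simpa using (hS B).const_mul ‖R‖)
      calc (2 ^ n)⁻¹ * ∑ ω, ‖R (S (B (z n ω)))‖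
          ≤ (2 ^ n)⁻¹ * ∑ ω, ‖R‖ * ‖S (B (z n ω))‖ := by gcongr with ω; exact R.le_opNorm _
        _ = ‖R‖ * ((2 ^ n)⁻¹ * ∑ ω, ‖S (B (z n ω))‖) := by rw [← Finset.mul_sum]; ring)
    (fun {R S} hR B => by rw [mul_assoc]; exact hR (S * B)),
  by
    rw [TwoSidedIdeal.coe_mk']
    refine isClosed_of_closure_subset fun R hR B => ?_
    have hC : 0 ≤ C := (norm_nonneg _).trans (hz 0 fun _ => true)
    rw [Metric.tendsto_atTop]
    intro ε hε
    obtain ⟨S, hS, hRS⟩ := Metric.mem_closure_iff.1 hR (ε / (2 * (‖B‖ * C + 1))) (by positivity)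
    obtain ⟨n₀, hn₀⟩ := Metric.tendsto_atTop.1 (hS B) (ε / 2) (by positivity)
    refine ⟨n₀, fun n hn => ?_⟩
    have h1 := hn₀ n hn
    rw [Real.dist_0_eq_abs, abs_of_nonneg (avgNorm_nonneg z _ n)] at h1 ⊢
    have h2 : avgNorm z ((R - S) * B) n ≤ ε / 2 := by
      refine avgNorm_le_of_forall_le fun ω => ?_
      rw [dist_eq_norm] at hRS
      calc ‖((R - S) * B) (z n ω)‖ ≤ ‖R - S‖ * (‖B‖ * ‖z n ω‖) :=
            ((R - S).le_opNorm _).trans (by gcongr; exact B.le_opNorm _)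
        _ ≤ ε / (2 * (‖B‖ * C + 1)) * (‖B‖ * C + 1) := by
            gcongr
            have := mul_le_mul_of_nonneg_left (hz n ω) (norm_nonneg B)
            linarith
        _ = ε / 2 := by field_simp
    have h3 := avgNorm_add_le z ((R - S) * B) (S * B) n
    rw [← add_mul, sub_add_cancel] at h3
    linarith⟩

lemma mem_avgIdeal {z : ∀ n : ℕ, (Fin n → Bool) → Z} {C : ℝ} (hz : ∀ n ω, ‖z n ω‖ ≤ C)
    {R : Operators 𝕜 Z} : R ∈ (avgIdeal z hz : ClosedIdeal 𝕜 Z).1 ↔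
      ∀ B : Operators 𝕜 Z, Tendsto (avgNorm z (R * B)) atTop (𝓝 0) := by
  simp [avgIdeal]

/-- The transpose of a continuous linear map. -/
noncomputable def transpose {Y : Type*} [NormedAddCommGroup Y] [NormedSpace 𝕜 Y] (R : Z →L[𝕜] Y) :
    StrongDual 𝕜 Y →L[𝕜] StrongDual 𝕜 Z :=
  (ContinuousLinearMap.compL 𝕜 Z Y 𝕜).flip R

lemma continuous_transpose :
    Continuous (transpose : Operators 𝕜 Z → Operators 𝕜 (StrongDual 𝕜 Z)) :=
  (ContinuousLinearMap.compL 𝕜 Z Z 𝕜).flip.continuous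

lemma transpose_zero : transpose (0 : Operators 𝕜 Z) = 0 :=
  map_zero (ContinuousLinearMap.compL 𝕜 Z Z 𝕜).flip

lemma transpose_add (R S : Operators 𝕜 Z) : transpose (R + S) = transpose R + transpose S :=
  map_add (ContinuousLinearMap.compL 𝕜 Z Z 𝕜).flip R S

lemma transpose_neg (R : Operators 𝕜 Z) : transpose (-R) = -transpose R :=
  map_neg (ContinuousLinearMap.compL 𝕜 Z Z 𝕜).flip R

lemma transpose_mul (R S : Operators 𝕜 Z) :
    (transpose (R * S) : Operators 𝕜 (StrongDual 𝕜 Z)) = transpose S * transpose R := rfl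

/-- The operators whose transpose lies in a given closed ideal form a closed ideal. -/
noncomputable def transposeIdeal (I : ClosedIdeal 𝕜 (StrongDual 𝕜 Z)) : ClosedIdeal 𝕜 Z :=
  ⟨TwoSidedIdeal.mk' {R | transpose R ∈ I.1}
    (by rw [Set.mem_ofPred_eq, transpose_zero]; exact I.1.zero_mem)
    (fun {R S} hR hS => by rw [Set.mem_ofPred_eq, transpose_add]; exact I.1.add_mem hR hS)
    (fun {R} hR => by rw [Set.mem_ofPred_eq, transpose_neg]; exact I.1.neg_mem hR)
    (fun {R S} hS => by
      rw [Set.mem_ofPred_eq, transpose_mul]; exact I.1.mul_mem_right _ (transpose R) hS)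
    (fun {R S} hR => by
      rw [Set.mem_ofPred_eq, transpose_mul]; exact I.1.mul_mem_left (transpose S) _ hR),
  by
    rw [TwoSidedIdeal.coe_mk']
    exact I.2.preimage continuous_transpose⟩

lemma mem_transposeIdeal {I : ClosedIdeal 𝕜 (StrongDual 𝕜 Z)} {R : Operators 𝕜 Z} :
    R ∈ (transposeIdeal I).1 ↔ transpose R ∈ I.1 := by
  simp [transposeIdeal]

end AverageIdeal

/-! ### Normalized Walsh and Rademacher vectors -/

section Blocks

variable {𝕜 : Type*} [RCLike 𝕜] {α : ℕ → Type} [∀ n, Fintype (α n)] [∀ n, DecidableEq (α n)]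
  {p p' : ℝ≥0∞} [Fact (1 ≤ p)]

/-- The element of `ℓ^p` that is supported on the `n`-th block and is given there by `f`. -/
noncomputable def blockVec (𝕜 : Type*) [RCLike 𝕜] {α : ℕ → Type} [∀ n, Fintype (α n)]
    [∀ n, DecidableEq (α n)] (p : ℝ≥0∞) [Fact (1 ≤ p)] (n : ℕ) :
    (α n → 𝕜) →ₗ[𝕜] lp (fun _ : (Σ n, α n) => 𝕜) p where
  toFun f := ∑ a, lp.single p ⟨n, a⟩ (f a)
  map_add' f g := by simp [lp.single_add, Finset.sum_add_distrib]
  map_smul' c f := by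
    rw [RingHom.id_apply, Finset.smul_sum]
    exact Finset.sum_congr rfl fun a _ =>
      lp.single_smul (E := fun _ : (Σ n, α n) => 𝕜) p ⟨n, a⟩ c (f a)

lemma blockVec_eq_sum (n : ℕ) (f : α n → 𝕜) :
    blockVec 𝕜 p n f = ∑ a, lp.single p ⟨n, a⟩ (f a) := rfl

lemma blockVec_apply (n : ℕ) (f : α n → 𝕜) (a : α n) : blockVec 𝕜 p n f ⟨n, a⟩ = f a := by
  rw [blockVec_eq_sum, lp.coeFn_sum, Finset.sum_apply, Finset.sum_eq_single a]
  · rw [lp.single_apply_self]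
  · intro b _ hb
    rw [lp.single_apply_ne]
    simpa using hb.symm
  · simp

lemma blockVec_apply_ne {n m : ℕ} (hmn : m ≠ n) (f : α n → 𝕜) (a : α m) :
    blockVec 𝕜 p n f ⟨m, a⟩ = 0 := by
  rw [blockVec_eq_sum, lp.coeFn_sum, Finset.sum_apply]
  refine Finset.sum_eq_zero fun b _ => ?_
  rw [lp.single_apply_ne]
  simp [hmn]

lemma norm_blockVec_rpow (hp : 0 < p.toReal) (n : ℕ) (f : α n → 𝕜) :
    ‖blockVec 𝕜 p n f‖ ^ p.toReal = ∑ a, ‖f a‖ ^ p.toReal := by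
  refine (hasSum_block_norm hp (blockVec 𝕜 p n f)).unique ?_
  convert hasSum_single n ?_ using 1
  · simp_rw [blockVec_apply]
  · intro m hm
    simp [blockVec_apply_ne hm, Real.zero_rpow hp.ne']

lemma blockVec_single (n : ℕ) (a : α n) :
    blockVec 𝕜 p n (Pi.single a 1) = lp.single p ⟨n, a⟩ (1 : 𝕜) := by
  rw [blockVec_eq_sum, Finset.sum_eq_single a]
  · simp
  · intro b _ hb
    simp [hb, lp.single_zero]
  · simp

/-- The normalized Walsh functions in `ℓ^p`. -/
noncomputable def walshVec (𝕜 : Type*) [RCLike 𝕜] (p : ℝ≥0∞) [Fact (1 ≤ p)] (n : ℕ)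
    (A : Fin n → Bool) : lp (fun _ : Cubes => 𝕜) p :=
  blockVec 𝕜 p n fun ω => (((2 ^ n : ℝ) ^ (-(1 / p.toReal)) : ℝ) : 𝕜) * (walsh A ω : 𝕜)

/-- The normalized Rademacher functions in `ℓ^p`. -/
noncomputable def rademacherVec (𝕜 : Type*) [RCLike 𝕜] (p : ℝ≥0∞) [Fact (1 ≤ p)] (m : ℕ)
    (k : Fin m) : lp (fun _ : Cubes => 𝕜) p :=
  blockVec 𝕜 p m fun ω => (((2 ^ m : ℝ) ^ (-(1 / p.toReal)) : ℝ) : 𝕜) * (rademacher k ω : 𝕜)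

lemma norm_normalization_rpow {r : ℝ} (hr : 0 < r) (n : ℕ) :
    ‖(((2 ^ n : ℝ) ^ (-(1 / r)) : ℝ) : 𝕜)‖ ^ r = (2 ^ n)⁻¹ := by
  rw [RCLike.norm_ofReal, abs_of_nonneg (by positivity), ← Real.rpow_mul (by positivity), neg_mul,
    one_div_mul_cancel hr.ne', Real.rpow_neg_one]

lemma ofReal_two_pow (n : ℕ) : ((2 ^ n : ℝ) : 𝕜) = 2 ^ n := by
  rw [RCLike.ofReal_pow, RCLike.ofReal_ofNat]

lemma normalization_mul {r r' : ℝ} (h : r.HolderConjugate r') (n : ℕ) :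
    (((2 ^ n : ℝ) ^ (-(1 / r')) : ℝ) : 𝕜) * (((2 ^ n : ℝ) ^ (-(1 / r)) : ℝ) : 𝕜) = (2 ^ n)⁻¹ := by
  have : (2 ^ n : ℝ) ^ (-(1 / r')) * (2 ^ n : ℝ) ^ (-(1 / r)) = (2 ^ n)⁻¹ := by
    rw [← Real.rpow_add (by positivity), ← neg_add, one_div, one_div, h.symm.inv_add_inv_eq_one,
      Real.rpow_neg_one]
  rw [← RCLike.ofReal_mul, this, RCLike.ofReal_inv, ofReal_two_pow]

lemma norm_walshVec (hp : 0 < p.toReal) (n : ℕ) (A : Fin n → Bool) : ‖walshVec 𝕜 p n A‖ = 1 := by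
  have h : ‖walshVec 𝕜 p n A‖ ^ p.toReal = 1 := by
    rw [walshVec, norm_blockVec_rpow hp]
    have : ∀ ω : Fin n → Bool, ‖(((2 ^ n : ℝ) ^ (-(1 / p.toReal)) : ℝ) : 𝕜) * (walsh A ω : 𝕜)‖ ^
        p.toReal = (2 ^ n)⁻¹ := fun ω => by
      rw [norm_mul, RCLike.norm_ofReal (walsh A ω), abs_walsh, mul_one, norm_normalization_rpow hp]
    simp_rw [this]
    simp
  exact (Real.rpow_left_inj (norm_nonneg _) zero_le_one hp.ne').1 (h.trans (Real.one_rpow _).symm)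

/-- Khinchin's upper bound: the Rademacher vectors have the upper `ℓ_2^m` estimate uniformly in `m`,
and continuous operators preserve it. -/
lemma exists_norm_sum_rademacherVec_le (𝕜 : Type*) [RCLike 𝕜] (hp : 0 < p.toReal) :
    ∃ K : ℝ, 0 < K ∧ ∀ (m : ℕ) (a : Fin m → 𝕜),
      ‖∑ k, a k • rademacherVec 𝕜 p m k‖ ≤ K * (∑ k, ‖a k‖ ^ 2) ^ (1 / 2 : ℝ) := by
  obtain ⟨K, hK, h⟩ := exists_sum_norm_rademacher_rpow_le 𝕜 hp
  refine ⟨K ^ (1 / p.toReal), by positivity, fun m a => ?_⟩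
  have hS : 0 ≤ ∑ k, ‖a k‖ ^ 2 := Finset.sum_nonneg fun k _ => sq_nonneg _
  have e : ∑ k, a k • rademacherVec 𝕜 p m k = blockVec 𝕜 p m fun ω =>
      (((2 ^ m : ℝ) ^ (-(1 / p.toReal)) : ℝ) : 𝕜) * ∑ k, (rademacher k ω : 𝕜) * a k := by
    simp_rw [rademacherVec, ← map_smul, ← map_sum]
    congr 1
    funext ω
    rw [Finset.sum_apply, Finset.mul_sum]
    refine Finset.sum_congr rfl fun k _ => ?_
    simp only [Pi.smul_apply, smul_eq_mul]
    ring
  rw [← Real.rpow_le_rpow_iff (norm_nonneg _) (by positivity) hp, e, norm_blockVec_rpow hp]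
  simp_rw [norm_mul, Real.mul_rpow (norm_nonneg _) (norm_nonneg _), norm_normalization_rpow hp]
  rw [← Finset.mul_sum, inv_mul_le_iff₀ (by positivity), Real.mul_rpow (by positivity)
    (by positivity), ← Real.rpow_mul hK.le, ← Real.rpow_mul hS, one_div_mul_cancel hp.ne',
    Real.rpow_one]
  refine (h m a).trans (le_of_eq ?_)
  rw [one_div_mul_eq_div]
  ring

/-- The two normalizations multiply to `2^(-n)`, so orthogonality of characters yields exactly a
unit vector. -/
lemma walshOp_walshVec [Fact (1 ≤ p')] (h2 : p.toReal < 2)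
    (h : p.toReal.HolderConjugate p'.toReal) (n : ℕ)
    (A : Fin n → Bool) :
    walshOp 𝕜 h2 h (walshVec 𝕜 p n A) = lp.single p' ⟨n, A⟩ (1 : 𝕜) := by
  rw [← blockVec_single]
  ext ⟨m, B⟩
  rw [walshOp_apply, walshVec]
  by_cases hmn : m = n
  · subst hmn
    simp_rw [blockVec_apply, mul_left_comm (walsh B _ : 𝕜), ← Finset.mul_sum]
    rw [← mul_assoc, normalization_mul h]
    have h1 : ∑ ω, (walsh B ω : 𝕜) * (walsh A ω : 𝕜) = if B = A then 2 ^ m else 0 := by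
      have := congrArg (fun t : ℝ => (t : 𝕜)) (sum_walsh_mul_walsh B A)
      push_cast at this
      rw [this]
      split_ifs
      · exact ofReal_two_pow _
      · exact RCLike.ofReal_zero
    rw [h1, Pi.single_apply]
    split_ifs <;> simp
  · simp_rw [blockVec_apply_ne hmn]
    simp

/-- The operator that maps an element of `ℓ^p` to the Rademacher coefficients of its blocks. -/
noncomputable def rademacherOp (𝕜 : Type*) [RCLike 𝕜] {p p' : ℝ≥0∞} [Fact (1 ≤ p)]
    (h2 : p.toReal < 2) (h : p.toReal.HolderConjugate p'.toReal) :
    lp (fun _ : Cubes => 𝕜) p →L[𝕜] lp (fun _ : (Σ m, Fin m) => 𝕜) 2 :=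
  lpCLM 2 (fun i => (((2 ^ i.1 : ℝ) ^ (-(1 / p'.toReal)) : ℝ) : 𝕜) •
      ∑ ω, (rademacher i.2 ω : 𝕜) • lp.evalCLM 𝕜 (fun _ : Cubes => 𝕜) p ⟨i.1, ω⟩) fun x => by
    have hp' := h.symm.pos
    obtain ⟨K, hK, hle⟩ := exists_sum_norm_sq_rademacher_coeff_le 𝕜 h
    -- Rademacher coefficients are bounded from `ℓ^p` to `ℓ^2` on each block; `p ≤ 2` lets the
    -- blocks be summed.
    refine memℓp_block h.pos (by simpa using h2.le) x K fun m => ?_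
    have h1 := hle m fun ω => x ⟨m, ω⟩
    have h3 : ((2 ^ m : ℝ) ^ (-(1 / p'.toReal))) ^ 2 = ((2 ^ m) ^ (2 / p'.toReal))⁻¹ := by
      rw [← Real.rpow_natCast, ← Real.rpow_mul (by positivity), ← Real.rpow_neg (by positivity)]
      congr 1
      push_cast
      ring
    calc _ = ((2 ^ m : ℝ) ^ (2 / p'.toReal))⁻¹ *
          ∑ k, ‖∑ ω, (rademacher k ω : 𝕜) * x ⟨m, ω⟩‖ ^ 2 := by
          rw [Finset.mul_sum]
          refine Finset.sum_congr rfl fun k _ => ?_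
          simp only [smul_apply, sum_apply, smul_eq_mul, norm_mul, RCLike.norm_ofReal,
            ENNReal.toReal_ofNat, Real.rpow_ofNat, mul_pow]
          rw [abs_of_nonneg (by positivity), h3]
          rfl
      _ ≤ ((2 ^ m : ℝ) ^ (2 / p'.toReal))⁻¹ * (K * (2 ^ m) ^ (2 / p'.toReal) *
          (∑ ω, ‖x ⟨m, ω⟩‖ ^ p.toReal) ^ (2 / p.toReal)) := by gcongr
      _ = _ := by
          rw [ENNReal.toReal_ofNat]
          field_simp

lemma rademacherOp_rademacherVec (h2 : p.toReal < 2) (h : p.toReal.HolderConjugate p'.toReal)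
    (m : ℕ) (k : Fin m) :
    rademacherOp 𝕜 h2 h (rademacherVec 𝕜 p m k) = lp.single 2 ⟨m, k⟩ (1 : 𝕜) := by
  rw [← blockVec_single]
  ext ⟨n, j⟩
  have e : rademacherOp 𝕜 h2 h (rademacherVec 𝕜 p m k) ⟨n, j⟩ =
      (((2 ^ n : ℝ) ^ (-(1 / p'.toReal)) : ℝ) : 𝕜) *
        ∑ ω, (rademacher j ω : 𝕜) * rademacherVec 𝕜 p m k ⟨n, ω⟩ := by
    simp only [rademacherOp, lpCLM_apply, smul_apply, sum_apply, smul_eq_mul]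
    rfl
  rw [e, rademacherVec]
  by_cases hmn : n = m
  · subst hmn
    simp_rw [blockVec_apply, mul_left_comm (rademacher j _ : 𝕜), ← Finset.mul_sum]
    rw [← mul_assoc, normalization_mul h]
    have h1 : ∑ ω, (rademacher j ω : 𝕜) * (rademacher k ω : 𝕜) = if j = k then 2 ^ n else 0 := by
      have := congrArg (fun t : ℝ => (t : 𝕜)) (sum_rademacher_mul_rademacher j k)
      push_cast at this
      rw [this]
      split_ifs
      · exact ofReal_two_pow _
      · exact RCLike.ofReal_zero
    rw [h1, Pi.single_apply]
    split_ifs <;> simp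
  · simp_rw [blockVec_apply_ne hmn]
    simp

end Blocks

/-! ### Separating the two operators by ideals -/

section Incomparable
open Filter Topology

variable {𝕜 : Type*} [RCLike 𝕜] {p p' : ℝ≥0∞} [Fact (1 ≤ p)] [Fact (1 ≤ p')]
  {Z : Type*} [NormedAddCommGroup Z] [NormedSpace 𝕜 Z]

/-- An operator that factors through a Hilbert space is small on average on the Walsh functions. -/
lemma sum_norm_hilbert_walshVec_le {H : Type*} [NormedAddCommGroup H]
    [InnerProductSpace 𝕜 H] (b : lp (fun _ : Cubes => 𝕜) p →L[𝕜] H) (n : ℕ) :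
    (2 ^ n)⁻¹ * ∑ A, ‖b (walshVec 𝕜 p n A)‖ ≤ ‖b‖ * (2 ^ n : ℝ) ^ (1 / 2 - 1 / p.toReal) := by
  set N : ℝ := 2 ^ n with hN
  have hN0 : 0 < N := by positivity
  set e : (Fin n → Bool) → lp (fun _ : Cubes => 𝕜) p := fun ω => lp.single p ⟨n, ω⟩ (1 : 𝕜) with he
  set c : ℝ := N ^ (-(1 / p.toReal)) with hc
  have hc0 : 0 < c := by positivity
  have h1 : ∀ A, ‖b (walshVec 𝕜 p n A)‖ = c * ‖∑ ω, (walsh A ω : 𝕜) • b (e ω)‖ := fun A => by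
    have : walshVec 𝕜 p n A = (c : 𝕜) • ∑ ω, (walsh A ω : 𝕜) • e ω := by
      rw [Finset.smul_sum, walshVec, blockVec_eq_sum]
      refine Finset.sum_congr rfl fun ω _ => ?_
      rw [he]
      simp only
      rw [← lp.single_smul, ← lp.single_smul, smul_eq_mul, smul_eq_mul, mul_one]
    rw [this, map_smul, norm_smul, RCLike.norm_ofReal, abs_of_pos hc0, map_sum]
    simp_rw [map_smul]
  -- Cauchy–Schwarz and Parseval gain a factor `N ^ (1/2)` over the trivial bound `N * N * ‖b‖`.
  have h3 : (∑ A : Fin n → Bool, ‖∑ ω, (walsh A ω : 𝕜) • b (e ω)‖) ^ 2 ≤ (N * N * ‖b‖) ^ 2 / N := by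
    have h4 : ∀ ω, ‖b (e ω)‖ ^ 2 ≤ ‖b‖ ^ 2 := fun ω => by
      have : ‖e ω‖ = 1 := by
        rw [he]
        simp only
        rw [lp.norm_single (zero_lt_one.trans_le Fact.out), norm_one]
      exact pow_le_pow_left₀ (norm_nonneg _)
        (by simpa only [this, mul_one] using b.le_opNorm (e ω)) 2
    calc _ ≤ (Finset.univ : Finset (Fin n → Bool)).card *
          ∑ A : Fin n → Bool, ‖∑ ω, (walsh A ω : 𝕜) • b (e ω)‖ ^ 2 := sq_sum_le_card_mul_sum_sq
      _ = N * (N * ∑ ω, ‖b (e ω)‖ ^ 2) := by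
          rw [sum_norm_sq_walsh]; simp [hN]
      _ ≤ N * (N * ∑ _ω : Fin n → Bool, ‖b‖ ^ 2) := by
          exact mul_le_mul_of_nonneg_left (mul_le_mul_of_nonneg_left
            (Finset.sum_le_sum fun ω _ => h4 ω) hN0.le) hN0.le
      _ = _ := by simp [hN]; field_simp
  have h5 : ∑ A : Fin n → Bool, ‖∑ ω, (walsh A ω : 𝕜) • b (e ω)‖ ≤ N * ‖b‖ * N ^ (1 / 2 : ℝ) := by
    refine abs_le_of_sq_le_sq' (h3.trans (le_of_eq ?_)) (by positivity) |>.2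
    have : (N ^ (1 / 2 : ℝ)) ^ 2 = N := by
      rw [← Real.rpow_natCast, ← Real.rpow_mul hN0.le]; norm_num
    rw [mul_pow _ (N ^ (1 / 2 : ℝ)), this]
    field_simp
  simp_rw [h1]
  rw [← Finset.mul_sum]
  calc N⁻¹ * (c * ∑ A : Fin n → Bool, ‖∑ ω, (walsh A ω : 𝕜) • b (e ω)‖)
      ≤ N⁻¹ * (c * (N * ‖b‖ * N ^ (1 / 2 : ℝ))) := by gcongr
    _ = ‖b‖ * (N ^ (1 / 2 : ℝ) * c) := by field_simp
    _ = _ := by rw [hc, ← Real.rpow_add hN0]; congr 2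

/-- The data that make the Walsh operator and the Rademacher operator on `Z` generate incomparable
closed ideals. -/
theorem exists_closedIdeal_walshOp_rademacherOp (h2 : p.toReal < 2)
    (h : p.toReal.HolderConjugate p'.toReal)
    {Q : Z →L[𝕜] lp (fun _ : Cubes => 𝕜) p} {U : lp (fun _ : Cubes => 𝕜) p →L[𝕜] Z}
    (hQU : ∀ x, Q (U x) = x) {J : lp (fun _ : Cubes => 𝕜) p' →L[𝕜] Z}
    {W : lp (fun _ : (Σ m, Fin m) => 𝕜) 2 →L[𝕜] Z} {c : ℝ} (hc : 0 < c)
    (hJ : ∀ i, c ≤ ‖J (lp.single p' i (1 : 𝕜))‖)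
    (hW : ∀ (m : ℕ) (ε : Fin m → Bool), c * √m ≤
      ‖W (∑ k, (rademacher k ε : 𝕜) • lp.single 2 ⟨m, k⟩ (1 : 𝕜))‖) :
    ∃ I I' : ClosedIdeal 𝕜 Z,
      (W ∘L rademacherOp 𝕜 h2 h ∘L Q ∈ I.1 ∧ W ∘L rademacherOp 𝕜 h2 h ∘L Q ∉ I'.1) ∧
      (J ∘L walshOp 𝕜 h2 h ∘L Q ∈ I'.1 ∧ J ∘L walshOp 𝕜 h2 h ∘L Q ∉ I.1) := by
  have hp := h.pos
  have hp' := h.symm.pos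
  have hlt := two_lt_of_holderConjugate h h2
  obtain ⟨K₀, hK₀, hrad⟩ := exists_norm_sum_rademacherVec_le (p := p) 𝕜 hp
  obtain ⟨K₁, hK₁, hmain⟩ := exists_sum_norm_walshOp_rpow_le (𝕜 := 𝕜) h2 h
  set y : ∀ n : ℕ, (Fin n → Bool) → Z := fun n A => U (walshVec 𝕜 p n A) with hy
  set z : ∀ n : ℕ, (Fin n → Bool) → Z := fun m ε =>
    (((√m)⁻¹ : ℝ) : 𝕜) • U (∑ k, (rademacher k ε : 𝕜) • rademacherVec 𝕜 p m k) with hz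
  have hyb : ∀ n A, ‖y n A‖ ≤ ‖U‖ := fun n A => by
    have := U.le_opNorm (walshVec 𝕜 p n A)
    rwa [norm_walshVec hp, mul_one] at this
  have hsq : ∀ (m : ℕ) (ε : Fin m → Bool), ∑ k, ‖(rademacher k ε : 𝕜)‖ ^ 2 = m := fun m ε => by
    simp [abs_rademacher]
  have hzb : ∀ m ε, ‖z m ε‖ ≤ ‖U‖ * K₀ := fun m ε => by
    have h1 := hrad m fun k => (rademacher k ε : 𝕜)
    rw [hsq, ← Real.sqrt_eq_rpow] at h1
    rw [hz]
    simp only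
    rw [norm_smul, RCLike.norm_ofReal, abs_of_nonneg (by positivity)]
    calc _ ≤ (√m)⁻¹ * (‖U‖ * (K₀ * √m)) := by
          gcongr
          exact (U.le_opNorm _).trans (by gcongr)
      _ = ‖U‖ * K₀ * ((√m)⁻¹ * √m) := by ring
      _ ≤ ‖U‖ * K₀ * 1 := by gcongr; exact inv_mul_le_one
      _ = _ := mul_one _
  have not_tendsto : ∀ (w : ∀ n : ℕ, (Fin n → Bool) → Z) (R : Operators 𝕜 Z),
      -- Block `0` is left out: there the normalized Rademacher sum is zero.
      (∀ n : ℕ, 1 ≤ n → c ≤ avgNorm w R n) →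
      ¬ ∀ B : Operators 𝕜 Z, Tendsto (avgNorm w (R * B)) atTop (𝓝 0) := by
    intro w R hR hB
    have h1 := hB 1
    rw [mul_one] at h1
    have := ge_of_tendsto h1 (eventually_atTop.2 ⟨1, hR⟩)
    linarith
  refine ⟨avgIdeal y hyb, avgIdeal z hzb, ⟨?_, ?_⟩, ?_, ?_⟩
  · rw [mem_avgIdeal]
    intro B
    set b : lp (fun _ : Cubes => 𝕜) p →L[𝕜] lp (fun _ : (Σ m, Fin m) => 𝕜) 2 :=
      rademacherOp 𝕜 h2 h ∘L Q ∘L B ∘L U with hb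
    have hlim : Tendsto (fun n : ℕ => ‖W‖ * (‖b‖ * (2 ^ n : ℝ) ^ (1 / 2 - 1 / p.toReal)))
        atTop (𝓝 0) := by
      have h1 : Tendsto (fun n : ℕ => (2 ^ n : ℝ)) atTop atTop :=
        tendsto_pow_atTop_atTop_of_one_lt (by norm_num)
      have h3 : 0 < 1 / p.toReal - 1 / 2 := by
        rw [sub_pos]; exact one_div_lt_one_div_of_lt hp h2
      have h4 := (tendsto_rpow_neg_atTop h3).comp h1
      rw [neg_sub] at h4
      simpa using (h4.const_mul ‖b‖).const_mul ‖W‖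
    refine squeeze_zero (avgNorm_nonneg y _) (fun n => ?_) hlim
    calc avgNorm y (W ∘L rademacherOp 𝕜 h2 h ∘L Q * B) n
        = (2 ^ n)⁻¹ * ∑ A, ‖W (b (walshVec 𝕜 p n A))‖ := rfl
      _ ≤ (2 ^ n)⁻¹ * ∑ A, ‖W‖ * ‖b (walshVec 𝕜 p n A)‖ := by
          gcongr with A; exact W.le_opNorm _
      _ = ‖W‖ * ((2 ^ n)⁻¹ * ∑ A, ‖b (walshVec 𝕜 p n A)‖) := by rw [← Finset.mul_sum]; ring
      _ ≤ _ := mul_le_mul_of_nonneg_left (sum_norm_hilbert_walshVec_le b n) (norm_nonneg W)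
  · rw [mem_avgIdeal]
    refine not_tendsto z _ fun m hm => le_avgNorm_of_forall_le fun ε => ?_
    have hm0 : 0 < √(m : ℝ) := Real.sqrt_pos.2 (by exact_mod_cast hm)
    have e : (W ∘L rademacherOp 𝕜 h2 h ∘L Q) (z m ε) = (((√m)⁻¹ : ℝ) : 𝕜) •
        W (∑ k, (rademacher k ε : 𝕜) • lp.single 2 ⟨m, k⟩ (1 : 𝕜)) := by
      simp only [hz, ContinuousLinearMap.comp_apply, map_smul, hQU, map_sum,
        rademacherOp_rademacherVec]
    rw [e, norm_smul, RCLike.norm_ofReal, abs_of_nonneg (by positivity), le_inv_mul_iff₀ hm0,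
      mul_comm]
    exact hW m ε
  · rw [mem_avgIdeal]
    intro B
    set b : lp (fun _ : Cubes => 𝕜) p →L[𝕜] lp (fun _ : Cubes => 𝕜) p := Q ∘L B ∘L U with hb
    -- The summand 1 keeps the weak norm bound positive even when `b = 0`.
    set C : ℝ := ‖b‖ * K₀ + 1 with hC
    have hC0 : 0 < C := by positivity
    set D : ℝ := ‖J‖ * (K₁ * C ^ p'.toReal) ^ (1 / p'.toReal) with hD
    have hlim : Tendsto (fun m : ℕ => D * (m : ℝ) ^ (-(1 / 2 - 1 / p'.toReal))) atTop (𝓝 0) := by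
      have h3 : 0 < 1 / 2 - 1 / p'.toReal := by
        rw [sub_pos]; exact one_div_lt_one_div_of_lt two_pos hlt
      simpa using ((tendsto_rpow_neg_atTop h3).comp tendsto_natCast_atTop_atTop).const_mul D
    refine squeeze_zero' (Eventually.of_forall (avgNorm_nonneg z _))
      (eventually_atTop.2 ⟨1, fun m hm => ?_⟩) hlim
    have hm0 : (0 : ℝ) < m := by exact_mod_cast hm
    set v : Fin m → lp (fun _ : Cubes => 𝕜) p := fun k => b (rademacherVec 𝕜 p m k) with hv
    have hvC : ∀ a : Fin m → 𝕜, ‖∑ k, a k • v k‖ ≤ C * (∑ k, ‖a k‖ ^ 2) ^ (1 / 2 : ℝ) := fun a => by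
      have e : ∑ k, a k • v k = b (∑ k, a k • rademacherVec 𝕜 p m k) := by
        simp only [hv, map_sum, map_smul]
      rw [e]
      calc _ ≤ ‖b‖ * (K₀ * (∑ k, ‖a k‖ ^ 2) ^ (1 / 2 : ℝ)) :=
            (b.le_opNorm _).trans (by gcongr; exact hrad m a)
        _ = ‖b‖ * K₀ * (∑ k, ‖a k‖ ^ 2) ^ (1 / 2 : ℝ) := by ring
        _ ≤ _ := by gcongr; linarith
    have h1 := hmain m v C hC0 hvC
    set t : (Fin m → Bool) → ℝ := fun ε =>
      ‖walshOp 𝕜 h2 h (∑ k, (rademacher k ε : 𝕜) • v k)‖ with ht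
    -- The power mean inequality passes from the `p'`-th moment to the mean, giving `m ^ (1/p')`
    -- against the normalization `√m`.
    have hjensen : (2 ^ m)⁻¹ * ∑ ε, t ε ≤ (K₁ * C ^ p'.toReal * m) ^ (1 / p'.toReal) := by
      have h3 := Real.arith_mean_le_rpow_mean (Finset.univ : Finset (Fin m → Bool))
        (fun _ => (2 ^ m)⁻¹) t (fun _ _ => by positivity) (by simp) (fun ε _ => norm_nonneg _)
        (by linarith : 1 ≤ p'.toReal)
      rw [← Finset.mul_sum, ← Finset.mul_sum] at h3
      refine h3.trans (Real.rpow_le_rpow (by positivity) ?_ (by positivity))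
      rw [inv_mul_le_iff₀ (by positivity)]
      refine h1.trans (le_of_eq (by ring))
    have e : ∀ ε, ‖((J ∘L walshOp 𝕜 h2 h ∘L Q) * B) (z m ε)‖ ≤ (√m)⁻¹ * (‖J‖ * t ε) := fun ε => by
      have e1 : ((J ∘L walshOp 𝕜 h2 h ∘L Q) * B) (z m ε) = (((√m)⁻¹ : ℝ) : 𝕜) •
          J (walshOp 𝕜 h2 h (∑ k, (rademacher k ε : 𝕜) • v k)) := by
        simp only [hz, hv, hb, mul_apply_eq_comp, ContinuousLinearMap.comp_apply,
          map_smul, map_sum]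
      rw [e1, norm_smul, RCLike.norm_ofReal, abs_of_nonneg (by positivity)]
      gcongr
      exact J.le_opNorm _
    calc avgNorm z ((J ∘L walshOp 𝕜 h2 h ∘L Q) * B) m
        ≤ (2 ^ m)⁻¹ * ∑ ε, (√m)⁻¹ * (‖J‖ * t ε) := by
          unfold avgNorm; gcongr with ε; exact e ε
      _ = (√m)⁻¹ * (‖J‖ * ((2 ^ m)⁻¹ * ∑ ε, t ε)) := by
          rw [← Finset.mul_sum, ← Finset.mul_sum]; ring
      _ ≤ (√m)⁻¹ * (‖J‖ * (K₁ * C ^ p'.toReal * m) ^ (1 / p'.toReal)) := by gcongr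
      _ = D * ((m : ℝ) ^ (1 / p'.toReal) * (√m)⁻¹) := by
          rw [Real.mul_rpow (by positivity) hm0.le]; ring
      _ = _ := by
          rw [Real.sqrt_eq_rpow, ← Real.rpow_neg hm0.le, ← Real.rpow_add hm0, neg_sub]
          rfl
  · rw [mem_avgIdeal]
    refine not_tendsto y _ fun n _ => le_avgNorm_of_forall_le fun A => ?_
    have e : (J ∘L walshOp 𝕜 h2 h ∘L Q) (y n A) = J (lp.single p' ⟨n, A⟩ (1 : 𝕜)) := by
      simp only [hy, ContinuousLinearMap.comp_apply, hQU, walshOp_walshVec]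
    rw [e]
    exact hJ _

end Incomparable

/-! ### Operators into `X` from copies of `ℓ^p`, `ℓ^q` and `c₀` -/

section Copies
open Filter Topology

variable {𝕜 : Type*} [RCLike 𝕜] {X : Type*} [NormedAddCommGroup X] [NormedSpace 𝕜 X]

lemma norm_lpReindex {ι κ : Type*} {p : ℝ≥0∞} [Fact (1 ≤ p)] (hp : 0 < p.toReal) (e : κ ≃ ι)
    (x : lp (fun _ : ι => 𝕜) p) : ‖lpReindex 𝕜 hp e x‖ = ‖x‖ := by
  have h1 := lp.hasSum_norm hp (lpReindex 𝕜 hp e x)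
  have h2 : HasSum (fun k => ‖lpReindex 𝕜 hp e x k‖ ^ p.toReal) (‖x‖ ^ p.toReal) :=
    e.hasSum_iff.2 (lp.hasSum_norm hp x)
  exact (Real.rpow_left_inj (norm_nonneg _) (norm_nonneg _) hp.ne').1 (h1.unique h2)

lemma exists_cubes_equiv_nat : Nonempty (Cubes ≃ ℕ) := by
  have : Infinite Cubes := Infinite.of_injective (fun n => ⟨n, fun _ => true⟩) fun m n h => by
    simpa using congrArg Sigma.fst h
  exact nonempty_equiv_of_countable

lemma ContainsCopy.exists_continuousLinearMap {E : Type*} [NormedAddCommGroup E] [NormedSpace 𝕜 E]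
    (h : ContainsCopy 𝕜 E X) : ∃ (j : E →L[𝕜] X) (c : ℝ), 0 < c ∧ ∀ x, c * ‖x‖ ≤ ‖j x‖ := by
  obtain ⟨W, -, ⟨e⟩⟩ := h
  refine ⟨W.subtypeL ∘L e.toContinuousLinearMap, (‖e.symm.toContinuousLinearMap‖ + 1)⁻¹,
    by positivity, fun x => ?_⟩
  rw [inv_mul_le_iff₀ (by positivity)]
  have h1 := e.symm.toContinuousLinearMap.le_opNorm (e x)
  have h2 : e.symm.toContinuousLinearMap (e x) = x := e.symm_apply_apply x
  rw [h2] at h1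
  have h3 : ‖(W.subtypeL ∘L e.toContinuousLinearMap) x‖ = ‖e x‖ := rfl
  rw [h3]
  nlinarith [norm_nonneg (e x)]

lemma ContainsComplementedCopy.exists_retraction {p : ℝ≥0∞} [Fact (1 ≤ p)] (hp : 0 < p.toReal)
    (h : ContainsComplementedCopy 𝕜 (lp (fun _ : ℕ => 𝕜) p) X) :
    ∃ (Q : X →L[𝕜] lp (fun _ : Cubes => 𝕜) p) (U : lp (fun _ : Cubes => 𝕜) p →L[𝕜] X),
      ∀ x, Q (U x) = x := by
  obtain ⟨W, ⟨P, hP⟩, ⟨e⟩⟩ := h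
  obtain ⟨d⟩ := exists_cubes_equiv_nat
  refine ⟨lpReindex 𝕜 hp d ∘L e.symm.toContinuousLinearMap ∘L P,
    W.subtypeL ∘L e.toContinuousLinearMap ∘L lpReindex 𝕜 hp d.symm, fun x => ?_⟩
  have h1 : P (W.subtypeL (e (lpReindex 𝕜 hp d.symm x))) = e (lpReindex 𝕜 hp d.symm x) := hP _
  simp only [ContinuousLinearMap.comp_apply, ContinuousLinearEquiv.coe_coe]
  rw [h1, e.symm_apply_apply]
  ext i
  simp

lemma sum_rademacher_smul_single (m : ℕ) (a : Fin m → 𝕜) :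
    ∑ k, a k • lp.single 2 ⟨m, k⟩ (1 : 𝕜) =
      blockVec 𝕜 (α := fun m => Fin m) 2 m a := by
  rw [blockVec_eq_sum]
  refine Finset.sum_congr rfl fun k _ => ?_
  rw [← lp.single_smul, smul_eq_mul, mul_one]

/-- The embedding of the Hilbert space `⨁ ℓ₂^m` into `ℓ^q` by means of Rademacher functions. -/
noncomputable def rademacherEmbedding (𝕜 : Type*) [RCLike 𝕜] {q : ℝ≥0∞} [Fact (1 ≤ q)]
    (hq : 2 ≤ q.toReal) :
    lp (fun _ : (Σ m, Fin m) => 𝕜) 2 →L[𝕜] lp (fun _ : Cubes => 𝕜) q :=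
  lpCLM q (fun i => (((2 ^ i.1 : ℝ) ^ (-(1 / q.toReal)) : ℝ) : 𝕜) •
      ∑ k, (rademacher k i.2 : 𝕜) • lp.evalCLM 𝕜 (fun _ : (Σ m, Fin m) => 𝕜) 2 ⟨i.1, k⟩)
    fun x => by
    have hq0 : 0 < q.toReal := by linarith
    obtain ⟨K, hK, hle⟩ := exists_sum_norm_rademacher_rpow_le 𝕜 hq0
    refine memℓp_block (by norm_num) (by simpa using hq) x K fun m => ?_
    have h1 := hle m fun k => x ⟨m, k⟩
    calc _ = (2 ^ m)⁻¹ * ∑ ε, ‖∑ k, (rademacher k ε : 𝕜) * x ⟨m, k⟩‖ ^ q.toReal := by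
          rw [Finset.mul_sum]
          refine Finset.sum_congr rfl fun ε _ => ?_
          simp only [smul_apply, sum_apply, smul_eq_mul, norm_mul]
          rw [Real.mul_rpow (norm_nonneg _) (norm_nonneg _), norm_normalization_rpow hq0]
          rfl
      _ ≤ (2 ^ m)⁻¹ * (K * 2 ^ m * (∑ k, ‖x ⟨m, k⟩‖ ^ 2) ^ (q.toReal / 2)) := by gcongr
      _ = _ := by
          simp only [ENNReal.toReal_ofNat, Real.rpow_ofNat]
          field_simp

lemma rademacherEmbedding_apply {q : ℝ≥0∞} [Fact (1 ≤ q)] (hq : 2 ≤ q.toReal)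
    (x : lp (fun _ : (Σ m, Fin m) => 𝕜) 2) (m : ℕ) (ε : Fin m → Bool) :
    rademacherEmbedding 𝕜 hq x ⟨m, ε⟩ = (((2 ^ m : ℝ) ^ (-(1 / q.toReal)) : ℝ) : 𝕜) *
      ∑ k, (rademacher k ε : 𝕜) * x ⟨m, k⟩ := by
  simp only [rademacherEmbedding, lpCLM_apply, smul_apply, sum_apply, smul_eq_mul]
  rfl

/-- Since `q ≥ 2`, the normalized `q`-mean over the cube dominates the quadratic mean, which equals
`√m` by orthogonality. -/
lemma sqrt_le_norm_rademacherEmbedding {q : ℝ≥0∞} [Fact (1 ≤ q)] (hq : 2 ≤ q.toReal) (m : ℕ)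
    (ε : Fin m → Bool) : √m ≤ ‖rademacherEmbedding 𝕜 hq
      (∑ k, (rademacher k ε : 𝕜) • lp.single 2 ⟨m, k⟩ (1 : 𝕜))‖ := by
  have hq0 : 0 < q.toReal := by linarith
  rw [sum_rademacher_smul_single]
  set x := blockVec 𝕜 (α := fun m => Fin m) 2 m fun k => (rademacher k ε : 𝕜) with hx
  set y := rademacherEmbedding 𝕜 hq x with hy
  set t : (Fin m → Bool) → ℝ := fun δ => ‖∑ k, (rademacher k δ : 𝕜) * (rademacher k ε : 𝕜)‖ with ht
  have h1 : (2 ^ m)⁻¹ * ∑ δ, (t δ ^ 2) ^ (q.toReal / 2) ≤ ‖y‖ ^ q.toReal := by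
    refine le_trans (le_of_eq ?_)
      (le_hasSum (hasSum_block_norm hq0 y) m fun _ _ => by positivity)
    rw [Finset.mul_sum]
    refine Finset.sum_congr rfl fun δ _ => ?_
    rw [hy, rademacherEmbedding_apply, norm_mul, Real.mul_rpow (norm_nonneg _) (norm_nonneg _),
      norm_normalization_rpow hq0, hx]
    simp_rw [blockVec_apply]
    have h0 : (t δ ^ 2) ^ (q.toReal / 2) = t δ ^ q.toReal := by
      rw [← Real.rpow_natCast (t δ) 2, ← Real.rpow_mul (norm_nonneg _)]
      congr 1
      push_cast
      ring
    rw [h0]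
  have h2 : (2 ^ m : ℝ)⁻¹ * ∑ δ, t δ ^ 2 = m := by
    have := sum_norm_sq_rademacher (𝕜 := 𝕜) fun k => (rademacher k ε : 𝕜)
    simp only [smul_eq_mul, RCLike.norm_ofReal (rademacher _ ε), abs_rademacher, one_pow,
      Finset.sum_const, Finset.card_univ, Fintype.card_fin, nsmul_eq_mul, mul_one] at this
    rw [this]
    field_simp
  have h3 := Real.arith_mean_le_rpow_mean (Finset.univ : Finset (Fin m → Bool))
    (fun _ => (2 ^ m)⁻¹) (fun δ => t δ ^ 2) (fun _ _ => by positivity) (by simp)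
    (fun δ _ => by positivity) ((one_le_div two_pos).2 hq)
  rw [← Finset.mul_sum, ← Finset.mul_sum, h2] at h3
  have h4 : (m : ℝ) ≤ ‖y‖ ^ 2 := by
    calc (m : ℝ) ≤ _ := h3
      _ ≤ (‖y‖ ^ q.toReal) ^ (1 / (q.toReal / 2)) := by gcongr
      _ = ‖y‖ ^ 2 := by
        rw [← Real.rpow_mul (norm_nonneg _), ← Real.rpow_natCast]
        congr 1
        push_cast
        field_simp
  exact Real.sqrt_le_iff.2 ⟨norm_nonneg _, h4⟩

/-- The embedding of the Hilbert space `⨁ ℓ₂^m` into `c₀` by means of Rademacher functions. -/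
noncomputable def rademacherEmbeddingZeroAtInfty (𝕜 : Type*) [RCLike 𝕜] (d : ℕ ≃ Cubes) :
    lp (fun _ : (Σ m, Fin m) => 𝕜) 2 →L[𝕜] C₀(ℕ, 𝕜) :=
  zeroAtInftyCLM (fun i => (((√(d i).1)⁻¹ : ℝ) : 𝕜) • ∑ k, (rademacher k (d i).2 : 𝕜) •
      lp.evalCLM 𝕜 (fun _ : (Σ m, Fin m) => 𝕜) 2 ⟨(d i).1, k⟩) fun x => by
    have hfst : Tendsto (fun i => (d i).1) cofinite atTop := by
      rw [← Nat.cofinite_eq_atTop]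
      have h1 : Tendsto (Sigma.fst : Cubes → ℕ) cofinite cofinite := by
        refine Tendsto.cofinite_of_finite_preimage_singleton fun n => ?_
        refine (Set.finite_range fun ω : Fin n → Bool => (⟨n, ω⟩ : Cubes)).subset ?_
        rintro ⟨m, ω⟩ rfl
        exact ⟨ω, rfl⟩
      exact h1.comp d.injective.tendsto_cofinite
    have h1 := (hasSum_block_norm (α := fun m => Fin m) (p := 2) (by norm_num)
      x).summable.tendsto_atTop_zero
    have h2 : Tendsto (fun i => √(∑ k, ‖x ⟨(d i).1, k⟩‖ ^ (2 : ℝ≥0∞).toReal)) cofinite (𝓝 0) := by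
      have := (Real.continuous_sqrt.tendsto 0).comp (h1.comp hfst)
      rw [Real.sqrt_zero] at this
      exact this
    -- Cauchy–Schwarz over `m` terms costs `√m`, which the normalization cancels; a coordinate is
    -- thus at most the `ℓ^2` norm of its block, which tends to zero.
    refine squeeze_zero_norm (fun i => ?_) h2
    set m := (d i).1 with hm
    simp only [smul_apply, sum_apply, smul_eq_mul, norm_mul, RCLike.norm_ofReal,
      ENNReal.toReal_ofNat, Real.rpow_ofNat]
    rw [abs_of_nonneg (by positivity)]
    have h3 : ‖∑ k, (rademacher k (d i).2 : 𝕜) *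
        lp.evalCLM 𝕜 (fun _ : (Σ m, Fin m) => 𝕜) 2 ⟨m, k⟩ x‖ ≤ ∑ k, ‖x ⟨m, k⟩‖ := by
      refine (norm_sum_le _ _).trans (le_of_eq (Finset.sum_congr rfl fun k _ => ?_))
      rw [norm_mul, RCLike.norm_ofReal, abs_rademacher, one_mul]
      rfl
    have h4 : ∑ k, ‖x ⟨m, k⟩‖ ≤ √m * √(∑ k, ‖x ⟨m, k⟩‖ ^ 2) := by
      rw [← Real.sqrt_mul (Nat.cast_nonneg m)]
      refine Real.le_sqrt_of_sq_le ?_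
      simpa using sq_sum_le_card_mul_sum_sq (s := Finset.univ) (f := fun k => ‖x ⟨m, k⟩‖)
    calc _ ≤ (√m)⁻¹ * (√m * √(∑ k, ‖x ⟨m, k⟩‖ ^ 2)) := by gcongr; exact h3.trans h4
      _ = (√m)⁻¹ * √m * √(∑ k, ‖x ⟨m, k⟩‖ ^ 2) := by ring
      _ ≤ 1 * √(∑ k, ‖x ⟨m, k⟩‖ ^ 2) := by gcongr; exact inv_mul_le_one
      _ = _ := one_mul _

lemma norm_apply_le_norm_zeroAtInfty (f : C₀(ℕ, 𝕜)) (i : ℕ) : ‖f i‖ ≤ ‖f‖ :=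
  f.toBCF.norm_coe_le_norm i

/-- At the point `ε` of the cube all signs agree and the value is `m / √m`. Only such sign vectors
are required to keep a large norm. -/
lemma sqrt_le_norm_rademacherEmbeddingZeroAtInfty (d : ℕ ≃ Cubes) (m : ℕ) (ε : Fin m → Bool) :
    √m ≤ ‖rademacherEmbeddingZeroAtInfty 𝕜 d
      (∑ k, (rademacher k ε : 𝕜) • lp.single 2 ⟨m, k⟩ (1 : 𝕜))‖ := by
  rw [sum_rademacher_smul_single]
  set x := blockVec 𝕜 (α := fun m => Fin m) 2 m fun k => (rademacher k ε : 𝕜) with hx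
  refine le_trans (le_of_eq ?_) (norm_apply_le_norm_zeroAtInfty _ (d.symm ⟨m, ε⟩))
  have e : ∀ i : ℕ, rademacherEmbeddingZeroAtInfty 𝕜 d x i =
      (((√(d i).1)⁻¹ : ℝ) : 𝕜) * ∑ k, (rademacher k (d i).2 : 𝕜) * x ⟨(d i).1, k⟩ := fun i => by
    simp only [rademacherEmbeddingZeroAtInfty, zeroAtInftyCLM_apply, smul_apply, sum_apply,
      smul_eq_mul]
    rfl
  rw [e, Equiv.apply_symm_apply]
  simp only [hx, blockVec_apply, ← RCLike.ofReal_mul, rademacher_mul_self]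
  simp only [RCLike.ofReal_one, Finset.sum_const, Finset.card_univ, Fintype.card_fin, nsmul_eq_mul,
    mul_one, norm_mul, RCLike.norm_ofReal, RCLike.norm_natCast]
  rw [abs_of_nonneg (by positivity), inv_mul_eq_div, Real.div_sqrt]

/-- A space containing a copy of `ℓ^q` or of `c₀` admits the operators required for
`exists_closedIdeal_walshOp_rademacherOp`. -/
lemma exists_operators_of_containsCopy {p' q : ℝ≥0∞} [Fact (1 ≤ p')] [Fact (1 ≤ q)]
    (hp' : 2 ≤ p'.toReal) (hp'q : p' ≤ q) (hq : q < ∞)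
    (h : ContainsCopy 𝕜 (lp (fun _ : ℕ => 𝕜) q) X ∨ ContainsCopy 𝕜 C₀(ℕ, 𝕜) X) :
    ∃ (J : lp (fun _ : Cubes => 𝕜) p' →L[𝕜] X)
      (W : lp (fun _ : (Σ m, Fin m) => 𝕜) 2 →L[𝕜] X) (c : ℝ), 0 < c ∧
      (∀ i, c ≤ ‖J (lp.single p' i (1 : 𝕜))‖) ∧
      ∀ (m : ℕ) (ε : Fin m → Bool), c * √m ≤
        ‖W (∑ k, (rademacher k ε : 𝕜) • lp.single 2 ⟨m, k⟩ (1 : 𝕜))‖ := by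
  obtain ⟨d⟩ := exists_cubes_equiv_nat
  rcases h with h | h
  · obtain ⟨j, c, hc, hj⟩ := h.exists_continuousLinearMap
    have hq2 : 2 ≤ q.toReal := hp'.trans (ENNReal.toReal_mono hq.ne hp'q)
    have hq0 : 0 < q.toReal := by linarith
    refine ⟨j ∘L lpReindex 𝕜 hq0 d.symm ∘L lpInclusion 𝕜 Cubes hp'q,
      j ∘L lpReindex 𝕜 hq0 d.symm ∘L rademacherEmbedding 𝕜 hq2, c, hc, fun i => ?_, fun m ε => ?_⟩
    · refine le_trans ?_ (hj (lpReindex 𝕜 hq0 d.symm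
        (lpInclusion 𝕜 Cubes hp'q (lp.single p' i (1 : 𝕜)))))
      rw [norm_lpReindex]
      refine le_mul_of_one_le_right hc.le ?_
      have h1 := lp.norm_apply_le_norm (ne_of_gt (zero_lt_one.trans_le Fact.out))
        (lpInclusion 𝕜 Cubes hp'q (lp.single p' i (1 : 𝕜))) i
      simpa using h1
    · have h1 : ∀ x, c * ‖rademacherEmbedding 𝕜 hq2 x‖ ≤
          ‖(j ∘L lpReindex 𝕜 hq0 d.symm ∘L rademacherEmbedding 𝕜 hq2) x‖ := fun x =>
        (congrArg (c * ·) (norm_lpReindex hq0 d.symm _)).symm.trans_le (hj _)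
      exact (mul_le_mul_of_nonneg_left (sqrt_le_norm_rademacherEmbedding hq2 m ε) hc.le).trans
        (h1 _)
  · obtain ⟨j, c, hc, hj⟩ := h.exists_continuousLinearMap
    have hp'0 : 0 < p'.toReal := by linarith
    refine ⟨j ∘L zeroAtInftyCLM (fun i => lp.evalCLM 𝕜 (fun _ : Cubes => 𝕜) p' (d.symm i))
      fun x => ?_, j ∘L rademacherEmbeddingZeroAtInfty 𝕜 d.symm, c, hc, fun i => ?_, fun m ε => ?_⟩
    · have h1 := ((lp.memℓp x).summable hp'0).tendsto_cofinite_zero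
      have h2 : Tendsto (fun i => (‖x i‖ ^ p'.toReal) ^ (p'.toReal)⁻¹) cofinite (𝓝 0) := by
        have := h1.rpow_const (p := (p'.toReal)⁻¹) (Or.inr (by positivity))
        rwa [Real.zero_rpow (by positivity)] at this
      have h3 : Tendsto (fun i => x i) cofinite (𝓝 0) := by
        rw [tendsto_zero_iff_norm_tendsto_zero]
        refine h2.congr fun i => ?_
        rw [← Real.rpow_mul (norm_nonneg _), mul_inv_cancel₀ hp'0.ne', Real.rpow_one]
      exact h3.comp d.symm.injective.tendsto_cofinite
    · refine le_trans ?_ (hj _)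
      refine le_mul_of_one_le_right hc.le ?_
      refine le_trans (le_of_eq ?_) (norm_apply_le_norm_zeroAtInfty _ (d i))
      change 1 = ‖(lp.single p' i (1 : 𝕜) : lp (fun _ : Cubes => 𝕜) p') (d.symm (d i))‖
      rw [Equiv.symm_apply_apply, lp.single_apply_self, norm_one]
    · have h1 : ∀ x, c * ‖rademacherEmbeddingZeroAtInfty 𝕜 d.symm x‖ ≤
          ‖(j ∘L rademacherEmbeddingZeroAtInfty 𝕜 d.symm) x‖ := fun x => hj _
      exact (mul_le_mul_of_nonneg_left (sqrt_le_norm_rademacherEmbeddingZeroAtInfty d.symm m ε)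
        hc.le).trans (h1 _)

end Copies

/-! ### Double transposes of operators factoring through a reflexive space -/

section Bidual
open NormedSpace

variable {𝕜 : Type*} [RCLike 𝕜] {E X : Type*} [NormedAddCommGroup E] [NormedSpace 𝕜 E]
  [NormedAddCommGroup X] [NormedSpace 𝕜 X]

lemma transpose_transpose_inclusionInDoubleDual (A : E →L[𝕜] X) (x : E) :
    transpose (transpose A) (inclusionInDoubleDual 𝕜 E x) = inclusionInDoubleDual 𝕜 X (A x) := rfl

/-- A reflexive space is a retract of its bidual. -/
lemma exists_retraction_bidual (h : Function.Surjective (inclusionInDoubleDual 𝕜 E)) :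
    ∃ r : StrongDual 𝕜 (StrongDual 𝕜 E) →L[𝕜] E,
      (∀ x, r (inclusionInDoubleDual 𝕜 E x) = x) ∧ ∀ ξ, inclusionInDoubleDual 𝕜 E (r ξ) = ξ := by
  let e := LinearIsometryEquiv.ofSurjective (inclusionInDoubleDualLi 𝕜 (E := E)) h
  exact ⟨e.symm.toContinuousLinearEquiv.toContinuousLinearMap, fun x => e.symm_apply_apply x,
    fun ξ => e.apply_symm_apply ξ⟩

lemma norm_inclusionInDoubleDual (x : X) : ‖inclusionInDoubleDual 𝕜 X x‖ = ‖x‖ :=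
  (inclusionInDoubleDualLi 𝕜 (E := X)).norm_map x

/-- The double transpose of `Q` takes values in the bidual of `E`, which `r` identifies with `E`;
the middle operator `A` therefore survives unchanged. -/
lemma transpose_transpose_comp {F : Type*} [NormedAddCommGroup F] [NormedSpace 𝕜 F]
    {r : StrongDual 𝕜 (StrongDual 𝕜 E) →L[𝕜] E} (hr : ∀ ξ, inclusionInDoubleDual 𝕜 E (r ξ) = ξ)
    (B : F →L[𝕜] X) (A : E →L[𝕜] F) (Q : X →L[𝕜] E) :
    transpose (transpose (B ∘L A ∘L Q)) =
      (inclusionInDoubleDual 𝕜 X ∘L B) ∘L A ∘L (r ∘L transpose (transpose Q)) := by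
  refine ContinuousLinearMap.ext fun η => ?_
  have e : transpose (transpose (B ∘L A ∘L Q)) η =
      transpose (transpose (B ∘L A)) (transpose (transpose Q) η) := rfl
  rw [e, ← hr (transpose (transpose Q) η), transpose_transpose_inclusionInDoubleDual]
  simp only [ContinuousLinearMap.comp_apply]

lemma not_le_of_mem_of_notMem {I I' : ClosedIdeal 𝕜 X} {R : Operators 𝕜 X} (h : R ∈ I.1)
    (h' : R ∉ I'.1) : ¬ I ≤ I' := fun hle => h' (hle h)

end Bidual

/-! ### The main theorem -/

theorem theorem1p2 {𝕜 : Type*} [RCLike 𝕜] {X : Type*} [NormedAddCommGroup X] [NormedSpace 𝕜 X]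
    [CompleteSpace X] (p p' q : ℝ≥0∞) [Fact (1 ≤ p)] [Fact (1 ≤ q)]
    (hp1 : 1 < p) (hp2 : p < 2) (hpp' : p.HolderConjugate p') (hp'q : p' ≤ q) (hq : q < ∞)
    (hX : ContainsComplementedCopy 𝕜 (lp (fun _ : ℕ => 𝕜) p) X)
    (hX' : ContainsCopy 𝕜 (lp (fun _ : ℕ => 𝕜) q) X ∨ ContainsCopy 𝕜 C₀(ℕ, 𝕜) X) :
    ((∃ I J : ClosedIdeal 𝕜 X, ¬ I ≤ J ∧ ¬ J ≤ I) ∧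
      (∃ I J : ClosedIdeal 𝕜 (StrongDual 𝕜 X), ¬ I ≤ J ∧ ¬ J ≤ I)) ∧
    (¬ (∀ I J : ClosedIdeal 𝕜 X, I ≤ J ∨ J ≤ I) ∧
      ¬ (∀ I J : ClosedIdeal 𝕜 (StrongDual 𝕜 X), I ≤ J ∨ J ≤ I)) := by
  have hptop : p ≠ ∞ := (hp2.trans (by simp)).ne
  have hp'top : p' ≠ ∞ := (hp'q.trans_lt hq).ne
  have : p'.HolderConjugate p := ENNReal.HolderConjugate.symm
  have : Fact (1 ≤ p') := ⟨ENNReal.HolderConjugate.one_le p' p⟩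
  have h : p.toReal.HolderConjugate p'.toReal :=
    ENNReal.HolderConjugate.toReal_of_ne_top hptop hp'top
  have h2 : p.toReal < 2 := by
    have := (ENNReal.toReal_lt_toReal hptop (by simp)).2 hp2
    simpa using this
  obtain ⟨Q, U, hQU⟩ := hX.exists_retraction h.pos
  obtain ⟨J, W, c, hc, hJ, hW⟩ := exists_operators_of_containsCopy
    (two_lt_of_holderConjugate h h2).le hp'q hq hX'
  have primal : ∃ I J : ClosedIdeal 𝕜 X, ¬ I ≤ J ∧ ¬ J ≤ I := by
    obtain ⟨I, I', ⟨h1, h3⟩, h4, h5⟩ :=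
      exists_closedIdeal_walshOp_rademacherOp h2 h hQU hc hJ hW
    exact ⟨I, I', not_le_of_mem_of_notMem h1 h3, not_le_of_mem_of_notMem h4 h5⟩
  have dual : ∃ I J : ClosedIdeal 𝕜 (StrongDual 𝕜 X), ¬ I ≤ J ∧ ¬ J ≤ I := by
    -- The bidual of `X` satisfies the same hypotheses: `r` after the double transpose of `Q` is a
    -- retraction onto `ℓ^p`, and `J`, `W` are followed by the isometric canonical inclusion. The
    -- resulting operators are double transposes, so their single transposes separate the
    -- pulled-back ideals on the dual.
    obtain ⟨r, hr1, hr2⟩ := exists_retraction_bidual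
      (surjective_inclusionInDoubleDual_lp (𝕜 := 𝕜) (ι := Cubes) hptop hp'top h)
    obtain ⟨I, I', ⟨h1, h3⟩, h4, h5⟩ :=
      exists_closedIdeal_walshOp_rademacherOp (Z := StrongDual 𝕜 (StrongDual 𝕜 X)) h2 h
        (Q := r ∘L transpose (transpose Q)) (U := NormedSpace.inclusionInDoubleDual 𝕜 X ∘L U)
        (J := NormedSpace.inclusionInDoubleDual 𝕜 X ∘L J)
        (W := NormedSpace.inclusionInDoubleDual 𝕜 X ∘L W)
        (fun x => by
          simp only [ContinuousLinearMap.comp_apply, transpose_transpose_inclusionInDoubleDual,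
            hQU, hr1])
        hc (fun k => (hJ k).trans_eq (norm_inclusionInDoubleDual _).symm)
        (fun m ε => (hW m ε).trans_eq (norm_inclusionInDoubleDual _).symm)
    rw [← transpose_transpose_comp hr2] at h1 h3 h4 h5
    refine ⟨transposeIdeal I, transposeIdeal I',
      not_le_of_mem_of_notMem (R := transpose (W ∘L rademacherOp 𝕜 h2 h ∘L Q)) ?_ ?_,
      not_le_of_mem_of_notMem (R := transpose (J ∘L walshOp 𝕜 h2 h ∘L Q)) ?_ ?_⟩
    all_goals rw [mem_transposeIdeal]
    exacts [h1, h3, h4, h5]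
  refine ⟨⟨primal, dual⟩, fun hall => ?_, fun hall => ?_⟩
  · obtain ⟨I, I', h1, h3⟩ := primal
    exact (hall I I').elim h1 h3
  · obtain ⟨I, I', h1, h3⟩ := dual
    exact (hall I I').elim h1 h3
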